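/- Let $k$ be a field, $Q$ a finite non-empty acyclic quiver, and $I$ an admissible ideal of the path algebra $kQ$ generated by monomial relations (paths of length at least $2$). For a finite-dimensional $k$-algebra $A$ let $A$-mod be the category of finitely generated left $A$-modules, put $\Lambda = A\otimes_k kQ/I$, and identify $\Lambda$-mod with the category $\mathrm{rep}(Q,I,A)$ of representations $X=(X_i,X_\alpha)_{i\in Q_0,\alpha\in Q_1}$ of $(Q,I)$ by finitely generated $A$-modules $X_i$ and $A$-maps $X_\alpha\colon X_{s(\alpha)}\to X_{e(\alpha)}$, where $s(\cdot)$, $e(\cdot)$ denote the starting and the ending vertex. Subcategories are full, closed under isomorphisms and additive. For a subcategory $\mathcal X$ of $A$-mod, $\mathrm{smon}(Q,I,\mathcal X)$ is the subcategory of $\mathrm{rep}(Q,I,A)$ of those $X$ such that (m1) for each vertex $i$ the sum $\sum_{e(\alpha)=i}\operatorname{Im}X_\alpha$ is direct; (m2) for each arrow $\alpha$, $\operatorname{Ker}X_\alpha=\sum_{p\in K_\alpha}\operatorname{Im}X_p$, where $K_\alpha$ is the set of paths $p$ of length at least $1$ with $e(p)=s(\alpha)$, $p\notin I$ and $\alpha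 p\in I$; (m3) for each vertex $i$, $X_i/\sum_{e(\alpha)=i}\operatorname{Im}X_\alpha\in\mathcal X$. An extension-closed subcategory $\mathcal F$ of an abelian category is an exact category whose conflations are the short exact sequences with all terms in $\mathcal F$; it is called Frobenius if it has enough projective objects and enough injective objects and its projective objects are exactly its injective objects. (a) For every finite-dimensional $k$-algebra $A$ and every extension-closed subcategory $\mathcal X$ of $A$-mod, $\mathrm{smon}(Q,I,\mathcal X)$ is extension-closed in $\Lambda$-mod, and it is Frobenius if and only if $\mathcal X$ is Frobenius. (b) This produces Frobenius subcategories of $\Lambda$-mod other than the category $\mathcal{GP}(\Lambda)$ of Gorenstein-projective modules: there are a finite-dimensional $k$-algebra $A$ and an extension-closed Frobenius subcategory $\mathcal X$ of $A$-mod such that $\mathrm{smon}(Q,I,\mathcal X)$ is Frobenius and is not contained in $\mathcal{GP}(\Lambda)$. -/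

import Mathlib

open CategoryTheory CategoryTheory.Limits

universe v u w w'

/-! ### Subcategories of an abelian category and their exact structure

A full subcategory closed under isomorphisms is an `ObjectProperty`. The ambient categories
`A`-mod and `rep(Q, I, A)` are themselves full subcategories, closed under kernels and cokernels,
of the abelian categories of all `A`-modules and of all representations of `Q` in `A`-modules, so
a sequence in them is exact if and only if it is exact there. Hence `𝓐` below stands for such an
ambient abelian subcategory of `C`, and `𝓕` for a subcategory of `𝓐`. -/

section ExactSubcategories

variable {C : Type u} [Category.{v} C] [Abelian C]

/-- `S` is a short exact sequence `0 ⟶ X₁ ⟶ X₂ ⟶ X₃ ⟶ 0` with all terms in `𝓕`. -/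
structure IsConflation (𝓕 : ObjectProperty C) (S : ShortComplex C) : Prop where
  shortExact : S.ShortExact
  left : 𝓕 S.X₁
  middle : 𝓕 S.X₂
  right : 𝓕 S.X₃

/-- `𝓕` is an extension-closed (additive) subcategory of `𝓐`. -/
structure IsExtensionClosedIn (𝓐 𝓕 : ObjectProperty C) : Prop where
  le : 𝓕 ≤ 𝓐
  closedUnderIso : 𝓕.IsClosedUnderIsomorphisms
  containsZero : 𝓕.ContainsZero
  ext : ∀ S : ShortComplex C, S.ShortExact → 𝓐 S.X₂ → 𝓕 S.X₁ → 𝓕 S.X₃ → 𝓕 S.X₂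

/-- `L` is a projective object of `𝓕`. -/
def IsProjectiveObject (𝓕 : ObjectProperty C) (L : C) : Prop :=
  𝓕 L ∧ ∀ S : ShortComplex C, IsConflation 𝓕 S →
    ∀ h : L ⟶ S.X₃, ∃ g : L ⟶ S.X₂, g ≫ S.g = h

/-- `L` is an injective object of `𝓕`. -/
def IsInjectiveObject (𝓕 : ObjectProperty C) (L : C) : Prop :=
  𝓕 L ∧ ∀ S : ShortComplex C, IsConflation 𝓕 S →
    ∀ h : S.X₁ ⟶ L, ∃ g : S.X₂ ⟶ L, S.f ≫ g = h

/-- Each `X` in `𝓕` has a sequence `0 ⟶ K ⟶ L ⟶ X ⟶ 0` in `𝓕` with `L` projective in `𝓕`. -/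
def HasEnoughProjectiveObjects (𝓕 : ObjectProperty C) : Prop :=
  ∀ X : C, 𝓕 X → ∃ (K L : C) (f : K ⟶ L) (g : L ⟶ X) (zero : f ≫ g = 0),
    IsConflation 𝓕 (ShortComplex.mk f g zero) ∧ IsProjectiveObject 𝓕 L

/-- Each `X` in `𝓕` has a sequence `0 ⟶ X ⟶ L ⟶ Z ⟶ 0` in `𝓕` with `L` injective in `𝓕`. -/
def HasEnoughInjectiveObjects (𝓕 : ObjectProperty C) : Prop :=
  ∀ X : C, 𝓕 X → ∃ (L Z : C) (f : X ⟶ L) (g : L ⟶ Z) (zero : f ≫ g = 0),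
    IsConflation 𝓕 (ShortComplex.mk f g zero) ∧ IsInjectiveObject 𝓕 L

/-- `𝓕` is a Frobenius subcategory of `𝓐`: it is extension-closed in `𝓐`, hence an exact category
in the canonical way, it has enough projective and enough injective objects, and these two
classes of objects coincide. -/
structure IsFrobeniusSubcategory (𝓐 𝓕 : ObjectProperty C) : Prop where
  extensionClosed : IsExtensionClosedIn 𝓐 𝓕
  enoughProjectives : HasEnoughProjectiveObjects 𝓕
  enoughInjectives : HasEnoughInjectiveObjects 𝓕
  projective_iff_injective : ∀ L : C, IsProjectiveObject 𝓕 L ↔ IsInjectiveObject 𝓕 L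

/-- `P` is a complete projective resolution in `𝓐`: an exact complex of projective objects of `𝓐`
that stays exact under `Hom(-, T)` for each projective object `T` of `𝓐`. -/
structure IsCompleteProjectiveResolution (𝓐 : ObjectProperty C) (P : CochainComplex C ℤ) :
    Prop where
  projective : ∀ n : ℤ, IsProjectiveObject 𝓐 (P.X n)
  exact : ∀ n : ℤ, P.ExactAt n
  homExact : ∀ T : C, IsProjectiveObject 𝓐 T → ∀ (n : ℤ) (f : P.X n ⟶ T),
    P.d (n - 1) n ≫ f = 0 → ∃ g : P.X (n + 1) ⟶ T, P.d n (n + 1) ≫ g = f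

/-- The subcategory `GP(𝓐)` of Gorenstein-projective objects of `𝓐`. -/
def gorensteinProjective (𝓐 : ObjectProperty C) : ObjectProperty C := fun M =>
  𝓐 M ∧ ∃ P : CochainComplex C ℤ, IsCompleteProjectiveResolution 𝓐 P ∧
    Nonempty (M ≅ kernel (P.d 0 1))

end ExactSubcategories

/-! ### Bound quivers with monomial relations -/

/-- The quiver has no oriented cycles. -/
def IsAcyclicQuiver (V : Type w) [Quiver.{w'} V] : Prop :=
  ∀ (i : V) (p : Quiver.Path i i), p.length = 0

/-- Monomial relations on a quiver: a set of paths of length at least two, so that (for a finite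
acyclic quiver) the ideal of the path algebra which they generate is admissible. -/
structure MonomialRelations (V : Type w) [Quiver.{w'} V] where
  rel : ∀ ⦃i j : V⦄, Set (Quiver.Path i j)
  two_le_length : ∀ ⦃i j : V⦄ (p : Quiver.Path i j), p ∈ rel (i := i) (j := j) → 2 ≤ p.length

namespace MonomialRelations

variable {V : Type w} [Quiver.{w'} V]

/-- The path `p` lies in the two-sided ideal `I` of the path algebra generated by the relations:
since they are paths, `I` is spanned by the paths which have one of them as a subpath, and any
path in `I` is of this form. -/
def Mem (I : MonomialRelations V) {i j : V} (p : Quiver.Path i j) : Prop :=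
  ∃ (a b : V) (q : Quiver.Path i a) (r : Quiver.Path a b) (s : Quiver.Path b j),
    r ∈ I.rel (i := a) (j := b) ∧ p = (q.comp r).comp s

/-- The paths from `h` to `s(α)` in the set `K_α`: those of length at least one, not in `I`, whose
continuation by `α` is in `I`. (Paths are composed here from left to right.) -/
def K (I : MonomialRelations V) {j i : V} (α : j ⟶ i) (h : V) : Set (Quiver.Path h j) :=
  {p | 1 ≤ p.length ∧ ¬ I.Mem p ∧ I.Mem (p.cons α)}

end MonomialRelations

/-! ### Representations over a ring and the separated monomorphism category -/

section Representations

variable {V : Type w} [Quiver.{w'} V]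

/-- Representations of the quiver `V` in (all) left `A`-modules, as functors on the category of
paths; the branch of `X` at `i` is `X.obj i`. -/
abbrev QuiverRep (V : Type w) [Quiver.{w'} V] (A : Type u) [Ring A] :=
  Paths V ⥤ ModuleCat.{u} A

variable {A : Type u} [Ring A]

/-- The `A`-linear map `X_p` from the branch at `i` to the branch at `j` along a path `p`. -/
def QuiverRep.pathMap (X : QuiverRep V A) {i j : V} (p : Quiver.Path i j) :
    X.obj ((Paths.of V).obj i) →ₗ[A] X.obj ((Paths.of V).obj j) :=
  (X.map (X := (Paths.of V).obj i) (Y := (Paths.of V).obj j) p).hom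

/-- The submodule of the branch at `i` that is the sum of the images of `X_α` for all arrows `α`
ending in `i`. -/
def QuiverRep.imageSum (X : QuiverRep V A) (i : V) :
    Submodule A (X.obj ((Paths.of V).obj i)) :=
  ⨆ α : Σ j : V, (j ⟶ i), LinearMap.range (X.pathMap α.2.toPath)

/-- `Cok_i(X)`. -/
def QuiverRep.cok (X : QuiverRep V A) (i : V) : ModuleCat.{u} A :=
  ModuleCat.of A (X.obj ((Paths.of V).obj i) ⧸ X.imageSum i)

variable (A) in
/-- `rep(Q, I, A)`: representations by finitely generated `A`-modules that satisfy the relations.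
This category is identified with the finitely generated left modules over `A ⊗ kQ/I`. -/
def boundRep (I : MonomialRelations V) : ObjectProperty (QuiverRep V A) := fun X =>
  (∀ i : V, ModuleCat.isFG A (X.obj ((Paths.of V).obj i))) ∧
    ∀ (i j : V) (p : Quiver.Path i j), p ∈ I.rel (i := i) (j := j) → X.pathMap p = 0

/-- `smon(Q, I, 𝒳)`: the separated monic representations over `𝒳`. -/
structure IsSeparatedMonic (I : MonomialRelations V) (𝒳 : ObjectProperty (ModuleCat.{u} A))
    (X : QuiverRep V A) : Prop where
  boundRep : boundRep A I X
  m1 : ∀ i : V, iSupIndep fun α : Σ j : V, (j ⟶ i) => LinearMap.range (X.pathMap α.2.toPath)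
  m2 : ∀ (j i : V) (α : j ⟶ i), LinearMap.ker (X.pathMap α.toPath) =
    ⨆ p : Σ h : V, I.K α h, LinearMap.range (X.pathMap p.2.1)
  m3 : ∀ i : V, 𝒳 (X.cok i)

/-- The subcategory `smon(Q, I, 𝒳)` of `rep(Q, I, A)`. -/
def smon (I : MonomialRelations V) (𝒳 : ObjectProperty (ModuleCat.{u} A)) :
    ObjectProperty (QuiverRep V A) :=
  fun X => IsSeparatedMonic I 𝒳 X

end Representations

/-! Conditions (m1) and (m2) merge into one, `QuiverRep.IsSeparated`: whenever `∑ X_α(x_α) = 0` over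
the arrows into a vertex, each `x_α` lies in the sum of the images along `K_α`. This is the
vanishing of a first homology, so cokernels at vertices are exact on sequences ending in a separated
representation, and extension-closedness follows by diagram chases.

The condition does not involve the scalars of `A`, so it passes along additive maps that commute
with the arrows. Over the field `k` a separated representation is free, a sum of one copy of `cok_i`
for each nonzero path starting at `i` (`IsSeparated.exists_free`). Hence sequences ending in a
separated representation split once `A` is forgotten. This replaces arguments with higher homology:
kernels of epimorphisms of separated representations are separated (`IsSeparated.kernel`), maps
injective on cokernels are injective (`IsSeparated.injective_of_cok_injective`), and images along
nonzero paths are filtered by cokernels, so that the branches lie in `𝒳` (`mem_imageSum`, `mem_br`).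

If `𝒳` is Frobenius, the representations `freeRep I M` do the work. They are projective when all `M
i` are projective in `𝒳`, by their universal property, and injective when all `M i` are injective,
by extending maps vertex by vertex (`exists_extension_of_isRelativelyInjective`). Covers and
embeddings of the modules `cok_i` lift to conflations with such middle terms, so every projective or
injective object is a summand of some `freeRep I M`, and the two classes agree.

Conversely, fix a sink `i`. Placing a module at `i` (`sky`) is an exact fully faithful functor from
`𝒳` into `smon`, with left adjoint `cok_i` and right adjoint the branch at `i`, both exact on
conflations. Projectives and injectives therefore pass in both directions.

For (b), take upper triangular `2 × 2` matrices and the modules fixed by the lower diagonal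
idempotent `e`. As `eAe = ke`, these are just vector spaces, and all conflations split. The simple
module among them embeds in no free module, so its copy at a sink embeds in no projective
representation and is not Gorenstein-projective. -/

/-! ### Elementwise description of representations -/

namespace QuiverRep

variable {V : Type w} [Quiver.{w'} V] {A : Type u} [Ring A]

/-- The branch of a representation at a vertex. -/
abbrev br (X : QuiverRep V A) (i : V) : ModuleCat.{u} A := X.obj ((Paths.of V).obj i)

lemma pathMap_nil (X : QuiverRep V A) (i : V) :
    X.pathMap (Quiver.Path.nil : Quiver.Path i i) = LinearMap.id := by
  have h := X.map_id ((Paths.of V).obj i)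
  exact congrArg ModuleCat.Hom.hom h

lemma pathMap_comp (X : QuiverRep V A) {i j l : V} (p : Quiver.Path i j) (q : Quiver.Path j l) :
    X.pathMap (p.comp q) = X.pathMap q ∘ₗ X.pathMap p := by
  have h := X.map_comp (X := (Paths.of V).obj i) (Y := (Paths.of V).obj j)
    (Z := (Paths.of V).obj l) p q
  exact congrArg ModuleCat.Hom.hom h

lemma pathMap_comp_apply (X : QuiverRep V A) {i j l : V} (p : Quiver.Path i j)
    (q : Quiver.Path j l) (x : X.br i) :
    X.pathMap (p.comp q) x = X.pathMap q (X.pathMap p x) := by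
  rw [pathMap_comp]; rfl

lemma pathMap_cons_apply (X : QuiverRep V A) {i j l : V} (p : Quiver.Path i j)
    (α : j ⟶ l) (x : X.br i) :
    X.pathMap (p.cons α) x = X.pathMap α.toPath (X.pathMap p x) :=
  pathMap_comp_apply X p α.toPath x

/-- The component of a morphism of representations at a vertex. -/
def homAt {X Y : QuiverRep V A} (f : X ⟶ Y) (i : V) : X.br i →ₗ[A] Y.br i :=
  (f.app ((Paths.of V).obj i)).hom

lemma homAt_pathMap {X Y : QuiverRep V A} (f : X ⟶ Y) {i j : V} (p : Quiver.Path i j)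
    (x : X.br i) : homAt f j (X.pathMap p x) = Y.pathMap p (homAt f i x) := by
  have h := f.naturality (X := (Paths.of V).obj i) (Y := (Paths.of V).obj j) p
  exact congrArg (fun g => g.hom x) h

lemma homAt_comp {X Y Z : QuiverRep V A} (f : X ⟶ Y) (g : Y ⟶ Z) (i : V) (x : X.br i) :
    homAt (f ≫ g) i x = homAt g i (homAt f i x) := rfl

lemma hom_ext {X Y : QuiverRep V A} {f g : X ⟶ Y} (h : ∀ i x, homAt f i x = homAt g i x) :
    f = g := by
  apply NatTrans.ext
  funext i
  apply ModuleCat.hom_ext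
  ext x
  exact h i x

lemma pathMap_induction {X Y : QuiverRep V A} {F : ∀ i, X.br i → Y.br i}
    (h : ∀ (i j : V) (α : i ⟶ j) (x : X.br i),
      F j (X.pathMap α.toPath x) = Y.pathMap α.toPath (F i x)) {i j : V} (p : Quiver.Path i j)
    (x : X.br i) : F j (X.pathMap p x) = Y.pathMap p (F i x) := by
  induction p with
  | nil => rw [pathMap_nil, pathMap_nil]; rfl
  | cons p α ih => rw [pathMap_cons_apply, h, ih, pathMap_cons_apply]

/-- A morphism of representations from linear maps that commute with the arrows. -/
def mkHom {X Y : QuiverRep V A} (F : ∀ i, X.br i →ₗ[A] Y.br i)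
    (h : ∀ (i j : V) (α : i ⟶ j) (x : X.br i),
      F j (X.pathMap α.toPath x) = Y.pathMap α.toPath (F i x)) : X ⟶ Y where
  app i := ModuleCat.ofHom (F i)
  naturality i j p := by
    apply ModuleCat.hom_ext
    ext x
    exact pathMap_induction (F := fun i => F i) h p x

@[simp] lemma homAt_mkHom {X Y : QuiverRep V A} (F : ∀ i, X.br i →ₗ[A] Y.br i)
    (h : ∀ (i j : V) (α : i ⟶ j) (x : X.br i),
      F j (X.pathMap α.toPath x) = Y.pathMap α.toPath (F i x)) (i : V) :
    homAt (mkHom F h) i = F i := rfl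

/-- The representation with prescribed branches and arrow maps. -/
def mkRep (M : V → ModuleCat.{u} A) (m : ∀ i j : V, (i ⟶ j) → (M i →ₗ[A] M j)) :
    QuiverRep V A :=
  Paths.lift { obj := M, map := fun {i j} α => ModuleCat.ofHom (m i j α) }

lemma mkRep_pathMap_toPath (M : V → ModuleCat.{u} A) (m : ∀ i j : V, (i ⟶ j) → (M i →ₗ[A] M j))
    {i j : V} (α : i ⟶ j) (x : M i) :
    (mkRep M m).pathMap α.toPath x = m i j α x := by
  have h := Paths.lift_toPath
    { obj := M, map := fun {i j} α => ModuleCat.ofHom (m i j α) : V ⥤q ModuleCat.{u} A } α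
  exact congrArg (fun g => g.hom x) h

lemma mono_of_injective {X Y : QuiverRep V A} (f : X ⟶ Y)
    (h : ∀ i, Function.Injective (homAt f i)) : Mono f := by
  have : ∀ i, Mono (f.app i) := fun i => (ModuleCat.mono_iff_injective _).2 (h i)
  exact NatTrans.mono_of_mono_app f

lemma epi_of_surjective {X Y : QuiverRep V A} (f : X ⟶ Y)
    (h : ∀ i, Function.Surjective (homAt f i)) : Epi f := by
  have : ∀ i, Epi (f.app i) := fun i => (ModuleCat.epi_iff_surjective _).2 (h i)
  exact NatTrans.epi_of_epi_app f

lemma exactAt_of_exact {S : ShortComplex (QuiverRep V A)} (h : S.Exact) (i : V) :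
    Function.Exact (homAt S.f i) (homAt S.g i) := by
  have h' := h.map ((evaluation (Paths V) (ModuleCat.{u} A)).obj ((Paths.of V).obj i))
  exact (ShortComplex.ShortExact.moduleCat_exact_iff_function_exact _).1 h'

lemma injective_of_mono {X Y : QuiverRep V A} (f : X ⟶ Y) [Mono f] (i : V) :
    Function.Injective (homAt f i) :=
  (ModuleCat.mono_iff_injective _).1 (inferInstance : Mono (f.app ((Paths.of V).obj i)))

lemma surjective_of_epi {X Y : QuiverRep V A} (f : X ⟶ Y) [Epi f] (i : V) :
    Function.Surjective (homAt f i) :=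
  (ModuleCat.epi_iff_surjective _).1 (inferInstance : Epi (f.app ((Paths.of V).obj i)))

lemma exact_of_exactAt {S : ShortComplex (QuiverRep V A)}
    (h : ∀ i, Function.Exact (homAt S.f i) (homAt S.g i)) : S.Exact := by
  rw [ShortComplex.exact_iff_isZero_homology, Functor.isZero_iff]
  intro i
  let ev := (evaluation (Paths V) (ModuleCat.{u} A)).obj i
  refine IsZero.of_iso ?_ (S.mapHomologyIso ev).symm
  rw [← ShortComplex.exact_iff_isZero_homology]
  exact (ShortComplex.ShortExact.moduleCat_exact_iff_function_exact _).2 (h i)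

lemma shortExact_iff {S : ShortComplex (QuiverRep V A)} :
    S.ShortExact ↔ ∀ i, Function.Injective (homAt S.f i) ∧
      Function.Exact (homAt S.f i) (homAt S.g i) ∧ Function.Surjective (homAt S.g i) := by
  constructor
  · intro h i
    have := h.mono_f
    have := h.epi_g
    exact ⟨injective_of_mono _ i, exactAt_of_exact h.exact i, surjective_of_epi _ i⟩
  · intro h
    have := mono_of_injective S.f fun i => (h i).1
    have := epi_of_surjective S.g fun i => (h i).2.2
    exact ⟨exact_of_exactAt fun i => (h i).2.1⟩

end QuiverRep

/-! ### Extension-closed subcategories of module categories -/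

section ModuleSubcategories

variable {A : Type u} [Ring A] {𝒳 : ObjectProperty (ModuleCat.{u} A)}
variable {M N M₁ M₂ M₃ : Type u} [AddCommGroup M] [AddCommGroup N] [AddCommGroup M₁]
  [AddCommGroup M₂] [AddCommGroup M₃] [Module A M] [Module A N] [Module A M₁] [Module A M₂]
  [Module A M₃]

/-- A module belongs to a subcategory of the category of modules. -/
abbrev ModMem (𝒳 : ObjectProperty (ModuleCat.{u} A)) (M : Type u) [AddCommGroup M] [Module A M] :
    Prop := 𝒳 (ModuleCat.of A M)

/-- The short complex given by two linear maps. -/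
abbrev linearShortComplex (f : M₁ →ₗ[A] M₂) (g : M₂ →ₗ[A] M₃) (h : Function.Exact f g) :
    ShortComplex (ModuleCat.{u} A) :=
  ShortComplex.mk (ModuleCat.ofHom f) (ModuleCat.ofHom g) (by
    apply ModuleCat.hom_ext
    ext x
    exact (h (f x)).2 ⟨x, rfl⟩)

lemma linearShortComplex_shortExact {f : M₁ →ₗ[A] M₂} {g : M₂ →ₗ[A] M₃}
    (hf : Function.Injective f) (h : Function.Exact f g) (hg : Function.Surjective g) :
    (linearShortComplex f g h).ShortExact :=
  ModuleCat.shortComplex_shortExact _ h hf hg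

namespace IsExtensionClosedIn

lemma finite (h𝒳 : IsExtensionClosedIn (ModuleCat.isFG A) 𝒳)
    (h : ModMem 𝒳 M) : Module.Finite A M := h𝒳.le _ h

lemma mem_of_equiv (h𝒳 : IsExtensionClosedIn (ModuleCat.isFG A) 𝒳)
    (e : M ≃ₗ[A] N) (h : ModMem 𝒳 M) : ModMem 𝒳 N :=
  have := h𝒳.closedUnderIso
  𝒳.prop_of_iso e.toModuleIso h

/-- Both targets are the quotient by the common kernel. Memberships of cokernels in `𝒳` are reduced
to this comparison of kernels. -/
lemma mem_of_ker_eq (h𝒳 : IsExtensionClosedIn (ModuleCat.isFG A) 𝒳)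
    {f : M →ₗ[A] M₁} {g : M →ₗ[A] M₂} (hf : Function.Surjective f)
    (hg : Function.Surjective g) (h : ∀ x, f x = 0 ↔ g x = 0) (h₁ : ModMem 𝒳 M₁) :
    ModMem 𝒳 M₂ := by
  have hk : LinearMap.ker f = LinearMap.ker g := by ext x; exact h x
  exact h𝒳.mem_of_equiv (((f.quotKerEquivOfSurjective hf).symm.trans
    (Submodule.quotEquivOfEq _ _ hk)).trans (g.quotKerEquivOfSurjective hg)) h₁

lemma mem_of_subsingleton (h𝒳 : IsExtensionClosedIn (ModuleCat.isFG A) 𝒳)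
    [Subsingleton M] : ModMem 𝒳 M := by
  have := h𝒳.closedUnderIso
  obtain ⟨Z, hZ, hZ'⟩ := h𝒳.containsZero
  refine 𝒳.prop_of_iso (hZ.iso ?_) hZ'
  exact ModuleCat.isZero_of_subsingleton _

lemma mem_of_exact (h𝒳 : IsExtensionClosedIn (ModuleCat.isFG A) 𝒳)
    [Module.Finite A M₂] {f : M₁ →ₗ[A] M₂} {g : M₂ →ₗ[A] M₃}
    (hf : Function.Injective f) (h : Function.Exact f g) (hg : Function.Surjective g)
    (h₁ : ModMem 𝒳 M₁) (h₃ : ModMem 𝒳 M₃) : ModMem 𝒳 M₂ :=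
  h𝒳.ext _ (linearShortComplex_shortExact hf h hg) (inferInstanceAs (Module.Finite A M₂)) h₁ h₃

lemma mem_of_submodule (h𝒳 : IsExtensionClosedIn (ModuleCat.isFG A) 𝒳)
    [Module.Finite A M] (W : Submodule A M) (h₁ : ModMem 𝒳 W)
    (h₂ : ModMem 𝒳 (M ⧸ W)) : ModMem 𝒳 M :=
  h𝒳.mem_of_exact W.subtype_injective (LinearMap.exact_subtype_mkQ W) W.mkQ_surjective h₁ h₂

lemma mem_bot (h𝒳 : IsExtensionClosedIn (ModuleCat.isFG A) 𝒳)
    : ModMem 𝒳 (⊥ : Submodule A M) := h𝒳.mem_of_subsingleton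

lemma mem_sup_of_disjoint (h𝒳 : IsExtensionClosedIn (ModuleCat.isFG A) 𝒳)
    [IsNoetherian A M] {W₁ W₂ : Submodule A M} (h : Disjoint W₁ W₂)
    (h₁ : ModMem 𝒳 W₁) (h₂ : ModMem 𝒳 W₂) : ModMem 𝒳 (W₁ ⊔ W₂ : Submodule A M) := by
  let f : W₁ × W₂ →ₗ[A] (W₁ ⊔ W₂ : Submodule A M) :=
    (Submodule.inclusion le_sup_left).coprod (Submodule.inclusion le_sup_right)
  have hf : Function.Bijective f := by
    constructor
    · rw [← LinearMap.ker_eq_bot, eq_bot_iff]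
      rintro ⟨⟨x, hx⟩, ⟨y, hy⟩⟩ hxy
      have hxy' : x + y = 0 := congrArg Subtype.val hxy
      have hx0 : x = 0 := by
        have : x ∈ (⊥ : Submodule A M) := h.le_bot ⟨hx, by
          rw [eq_neg_of_add_eq_zero_left hxy']; exact W₂.neg_mem hy⟩
        simpa using this
      subst hx0
      have hy0 : y = 0 := by simpa using hxy'
      subst hy0
      rfl
    · rintro ⟨z, hz⟩
      obtain ⟨x, hx, y, hy, rfl⟩ := Submodule.mem_sup.1 hz
      exact ⟨(⟨x, hx⟩, ⟨y, hy⟩), rfl⟩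
  refine h𝒳.mem_of_equiv (LinearEquiv.ofBijective f hf) ?_
  exact h𝒳.mem_of_exact (f := LinearMap.inl A W₁ W₂) (g := LinearMap.snd A W₁ W₂)
    LinearMap.inl_injective Function.Exact.inl_snd LinearMap.snd_surjective h₁ h₂

lemma mem_iSup_of_iSupIndep (h𝒳 : IsExtensionClosedIn (ModuleCat.isFG A) 𝒳)
    [IsNoetherian A M] {ι : Type*} [Finite ι] {W : ι → Submodule A M}
    (h : iSupIndep W) (hW : ∀ i, ModMem 𝒳 (W i)) : ModMem 𝒳 (⨆ i, W i : Submodule A M) := by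
  classical
  have := Fintype.ofFinite ι
  have key : ∀ s : Finset ι, ModMem 𝒳 (s.sup W : Submodule A M) := by
    intro s
    induction s using Finset.induction_on with
    | empty => rw [Finset.sup_empty]; exact h𝒳.mem_bot
    | insert a s ha ih =>
      rw [Finset.sup_insert]
      refine h𝒳.mem_sup_of_disjoint ?_ (hW a) ih
      exact h.supIndep' (insert a s) (Finset.subset_insert a s) (Finset.mem_insert_self a s) ha
  have := key Finset.univ
  rwa [Finset.sup_univ_eq_iSup] at this

end IsExtensionClosedIn

lemma IsProjectiveObject.exists_lift {P : Type u} [AddCommGroup P] [Module A P]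
    (hP : IsProjectiveObject 𝒳 (ModuleCat.of A P)) {f : M₁ →ₗ[A] M₂} {g : M₂ →ₗ[A] M₃}
    (hf : Function.Injective f) (h : Function.Exact f g) (hg : Function.Surjective g)
    (h₁ : ModMem 𝒳 M₁) (h₂ : ModMem 𝒳 M₂) (h₃ : ModMem 𝒳 M₃) (a : P →ₗ[A] M₃) :
    ∃ b : P →ₗ[A] M₂, ∀ x, g (b x) = a x := by
  obtain ⟨b, hb⟩ := hP.2 _ ⟨linearShortComplex_shortExact hf h hg, h₁, h₂, h₃⟩
    (ModuleCat.ofHom a)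
  exact ⟨b.hom, fun x => congrArg (fun t => t.hom x) hb⟩

lemma IsInjectiveObject.exists_extension {J : Type u} [AddCommGroup J] [Module A J]
    (hJ : IsInjectiveObject 𝒳 (ModuleCat.of A J)) {f : M₁ →ₗ[A] M₂} {g : M₂ →ₗ[A] M₃}
    (hf : Function.Injective f) (h : Function.Exact f g) (hg : Function.Surjective g)
    (h₁ : ModMem 𝒳 M₁) (h₂ : ModMem 𝒳 M₂) (h₃ : ModMem 𝒳 M₃) (a : M₁ →ₗ[A] J) :
    ∃ b : M₂ →ₗ[A] J, ∀ x, b (f x) = a x := by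
  obtain ⟨b, hb⟩ := hJ.2 _ ⟨linearShortComplex_shortExact hf h hg, h₁, h₂, h₃⟩
    (ModuleCat.ofHom a)
  exact ⟨b.hom, fun x => congrArg (fun t => t.hom x) hb⟩

/-- Homomorphisms to `N` extend along submodules in `𝒳` with quotient in `𝒳`. -/
def IsRelativelyInjective (𝒳 : ObjectProperty (ModuleCat.{u} A)) (N : Type u) [AddCommGroup N]
    [Module A N] : Prop :=
  ∀ (M : ModuleCat.{u} A) (W : Submodule A M), ModMem 𝒳 W → 𝒳 M → ModMem 𝒳 (M ⧸ W) →
    ∀ a : W →ₗ[A] N, ∃ b : M →ₗ[A] N, ∀ x : W, b x = a x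

lemma IsInjectiveObject.isRelativelyInjective {J : ModuleCat.{u} A}
    (hJ : IsInjectiveObject 𝒳 J) : IsRelativelyInjective 𝒳 J := by
  intro M W h₁ h₂ h₃ a
  exact IsInjectiveObject.exists_extension (J := J) hJ W.subtype_injective
    (LinearMap.exact_subtype_mkQ W) W.mkQ_surjective h₁ h₂ h₃ a

/-- `ψ` descends to `D / ker φ`, which is the range of `φ`. Only the range has to lie in `𝒳`, not
`D`, which will be a sum of branches over arrows. -/
lemma IsRelativelyInjective.exists_factor {N : Type u} [AddCommGroup N] [Module A N]
    (hN : IsRelativelyInjective 𝒳 N) {M : ModuleCat.{u} A} {D : Type*} [AddCommGroup D]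
    [Module A D] (φ : D →ₗ[A] M) (ψ : D →ₗ[A] N) (hk : ∀ d, φ d = 0 → ψ d = 0)
    (h₁ : ModMem 𝒳 (LinearMap.range φ)) (h₂ : 𝒳 M) (h₃ : ModMem 𝒳 (M ⧸ LinearMap.range φ)) :
    ∃ b : M →ₗ[A] N, ∀ d, b (φ d) = ψ d := by
  let a : LinearMap.range φ →ₗ[A] N :=
    (LinearMap.ker φ).liftQ ψ hk ∘ₗ φ.quotKerEquivRange.symm.toLinearMap
  obtain ⟨b, hb⟩ := hN M _ h₁ h₂ h₃ a
  refine ⟨b, fun d => (hb ⟨φ d, d, rfl⟩).trans ?_⟩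
  have : φ.quotKerEquivRange.symm ⟨φ d, d, rfl⟩ = Submodule.Quotient.mk d := by
    rw [LinearEquiv.symm_apply_eq]; rfl
  change (LinearMap.ker φ).liftQ ψ hk (φ.quotKerEquivRange.symm ⟨φ d, d, rfl⟩) = ψ d
  rw [this]
  exact Submodule.liftQ_apply _ _ _

end ModuleSubcategories

/-! ### Separated representations -/

/-- The arrows ending in a vertex. -/
abbrev InArrow {V : Type w} [Quiver.{w'} V] (i : V) := Σ j : V, (j ⟶ i)

/-- Every path of the ideal has length at least two. -/
lemma MonomialRelations.Mem.two_le_length {V : Type w} [Quiver.{w'} V] {I : MonomialRelations V}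
    {i j : V} {p : Quiver.Path i j} (h : I.Mem p) : 2 ≤ p.length := by
  obtain ⟨a, b, q, r, s, hr, rfl⟩ := h
  have := I.two_le_length r hr
  rw [Quiver.Path.length_comp, Quiver.Path.length_comp]
  omega

lemma MonomialRelations.Mem.comp_right {V : Type w} [Quiver.{w'} V] {I : MonomialRelations V}
    {i j l : V} {p : Quiver.Path i j} (h : I.Mem p) (t : Quiver.Path j l) : I.Mem (p.comp t) := by
  obtain ⟨a, b, q, r, s, hr, rfl⟩ := h
  exact ⟨a, b, q, r, s.comp t, hr, by rw [Quiver.Path.comp_assoc]⟩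

lemma MonomialRelations.Mem.comp_left {V : Type w} [Quiver.{w'} V] {I : MonomialRelations V}
    {i j l : V} {p : Quiver.Path j l} (h : I.Mem p) (t : Quiver.Path i j) : I.Mem (t.comp p) := by
  obtain ⟨a, b, q, r, s, hr, rfl⟩ := h
  exact ⟨a, b, t.comp q, r, s, hr, by simp only [Quiver.Path.comp_assoc]⟩

lemma MonomialRelations.Mem.of_rel {V : Type w} [Quiver.{w'} V] {I : MonomialRelations V}
    {i j : V} {p : Quiver.Path i j} (h : p ∈ I.rel (i := i) (j := j)) : I.Mem p :=
  ⟨i, j, .nil, p, .nil, h, by simp⟩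

namespace QuiverRep

variable {V : Type w} [Quiver.{w'} V] {A : Type u} [Ring A] {B : Type u} [Ring B]

/-- The representation satisfies the relations. -/
def SatisfiesRelations (I : MonomialRelations V) (X : QuiverRep V A) : Prop :=
  ∀ (i j : V) (p : Quiver.Path i j), p ∈ I.rel (i := i) (j := j) → X.pathMap p = 0

lemma SatisfiesRelations.pathMap_eq_zero {I : MonomialRelations V} {X : QuiverRep V A}
    (hX : X.SatisfiesRelations I) {i j : V} {p : Quiver.Path i j} (hp : I.Mem p) (x : X.br i) :
    X.pathMap p x = 0 := by
  obtain ⟨a, b, q, r, s, hr, rfl⟩ := hp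
  rw [pathMap_comp_apply, pathMap_comp_apply, hX _ _ r hr]
  simp

/-- The sum of the images of the maps along the paths in `K_α`. -/
def relKernel (I : MonomialRelations V) (X : QuiverRep V A) {j i : V} (α : j ⟶ i) :
    Submodule A (X.br j) :=
  ⨆ p : Σ h : V, I.K α h, LinearMap.range (X.pathMap p.2.1)

lemma pathMap_mem_relKernel (I : MonomialRelations V) (X : QuiverRep V A) {j i : V} (α : j ⟶ i)
    {h : V} {p : Quiver.Path h j} (hp : p ∈ I.K α h) (x : X.br h) :
    X.pathMap p x ∈ X.relKernel I α :=
  le_iSup (fun p : Σ h : V, I.K α h => LinearMap.range (X.pathMap p.2.1)) ⟨h, p, hp⟩ ⟨x, rfl⟩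

lemma relKernel_induction {I : MonomialRelations V} {X : QuiverRep V A} {j i : V} {α : j ⟶ i}
    {P : X.br j → Prop} (h₀ : P 0) (hadd : ∀ x y, P x → P y → P (x + y))
    (hp : ∀ (h : V) (p : Quiver.Path h j), p ∈ I.K α h → ∀ x, P (X.pathMap p x))
    {x : X.br j} (hx : x ∈ X.relKernel I α) : P x := by
  refine Submodule.iSup_induction _ (motive := P) hx ?_ h₀ hadd
  rintro ⟨h, p, hp'⟩ _ ⟨y, rfl⟩
  exact hp h p hp' y

lemma SatisfiesRelations.pathMap_relKernel {I : MonomialRelations V} {X : QuiverRep V A}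
    (hX : X.SatisfiesRelations I) {j i : V} {α : j ⟶ i} {x : X.br j}
    (hx : x ∈ X.relKernel I α) : X.pathMap α.toPath x = 0 := by
  refine relKernel_induction (P := fun x => X.pathMap α.toPath x = 0) (map_zero _) ?_ ?_ hx
  · intro x y h₁ h₂
    rw [map_add, h₁, h₂, add_zero]
  · intro h p hp x
    rw [← pathMap_cons_apply]
    exact hX.pathMap_eq_zero hp.2.2 x

/-- A family of additive maps that commutes with the arrow maps. -/
def IsAddMap (X : QuiverRep V A) (Y : QuiverRep V B) (F : ∀ i, X.br i →+ Y.br i) : Prop :=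
  ∀ (i j : V) (α : i ⟶ j) (x : X.br i),
    F j (X.pathMap α.toPath x) = Y.pathMap α.toPath (F i x)

namespace IsAddMap

variable {X : QuiverRep V A} {Y : QuiverRep V B} {F : ∀ i, X.br i →+ Y.br i}

lemma pathMap (hF : IsAddMap X Y F) {i j : V} (p : Quiver.Path i j) (x : X.br i) :
    F j (X.pathMap p x) = Y.pathMap p (F i x) := by
  induction p with
  | nil => rw [pathMap_nil, pathMap_nil]; rfl
  | cons p α ih => rw [pathMap_cons_apply, hF, ih, pathMap_cons_apply]

lemma mem_relKernel (hF : IsAddMap X Y F) {I : MonomialRelations V} {j i : V} {α : j ⟶ i}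
    {x : X.br j} (hx : x ∈ X.relKernel I α) : F j x ∈ Y.relKernel I α := by
  refine relKernel_induction (P := fun x => F j x ∈ Y.relKernel I α) ?_ ?_ ?_ hx
  · rw [map_zero]; exact zero_mem _
  · intro x y h₁ h₂
    rw [map_add]; exact add_mem h₁ h₂
  · intro h p hp x
    rw [hF.pathMap]; exact pathMap_mem_relKernel I Y α hp _

lemma exists_mem_relKernel (hF : IsAddMap X Y F) (hs : ∀ i, Function.Surjective (F i))
    {I : MonomialRelations V} {j i : V} {α : j ⟶ i}
    {y : Y.br j} (hy : y ∈ Y.relKernel I α) : ∃ x ∈ X.relKernel I α, F j x = y := by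
  refine relKernel_induction (P := fun y => ∃ x ∈ X.relKernel I α, F j x = y) ?_ ?_ ?_ hy
  · exact ⟨0, zero_mem _, map_zero _⟩
  · rintro _ _ ⟨x, hx, rfl⟩ ⟨y, hy, rfl⟩
    exact ⟨x + y, add_mem hx hy, map_add _ _ _⟩
  · intro h p hp y
    obtain ⟨x, rfl⟩ := hs h y
    exact ⟨_, pathMap_mem_relKernel I X α hp x, hF.pathMap p x⟩

end IsAddMap

lemma homAt_isAddMap {X Y : QuiverRep V A} (f : X ⟶ Y) :
    IsAddMap X Y fun i => (homAt f i).toAddMonoidHom :=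
  fun _ _ α x => homAt_pathMap f α.toPath x

lemma pathMap_mem_imageSum (X : QuiverRep V A) {j i : V} (α : j ⟶ i) (x : X.br j) :
    X.pathMap α.toPath x ∈ X.imageSum i :=
  le_iSup (fun α : InArrow i => LinearMap.range (X.pathMap α.2.toPath)) ⟨j, α⟩ ⟨x, rfl⟩

/-- The projection onto the cokernel. -/
def cokπ (X : QuiverRep V A) (i : V) : X.br i →ₗ[A] X.cok i := (X.imageSum i).mkQ

lemma cokπ_surjective (X : QuiverRep V A) (i : V) : Function.Surjective (X.cokπ i) :=
  (X.imageSum i).mkQ_surjective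

lemma cokπ_eq_zero_iff {X : QuiverRep V A} {i : V} {x : X.br i} :
    X.cokπ i x = 0 ↔ x ∈ X.imageSum i :=
  Submodule.Quotient.mk_eq_zero _

/-! ### Sums over incoming arrows, and separatedness as vanishing homology. -/

section Finite

variable [∀ i : V, Fintype (InArrow i)]

/-- The map from the sum of the branches at the starting vertices of the arrows ending in `i`. -/
def arrowSum (X : QuiverRep V A) (i : V) : (∀ α : InArrow i, X.br α.1) →ₗ[A] X.br i :=
  ∑ α : InArrow i, X.pathMap α.2.toPath ∘ₗ LinearMap.proj α

lemma arrowSum_apply (X : QuiverRep V A) (i : V) (x : ∀ α : InArrow i, X.br α.1) :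
    X.arrowSum i x = ∑ α : InArrow i, X.pathMap α.2.toPath (x α) := by
  simp [arrowSum]

open Classical in
lemma arrowSum_single (X : QuiverRep V A) {i : V} (α : InArrow i) (x : X.br α.1) :
    X.arrowSum i (Pi.single α x) = X.pathMap α.2.toPath x := by
  rw [arrowSum_apply, Finset.sum_eq_single α]
  · rw [Pi.single_eq_same]
  · intro β _ hβ
    rw [Pi.single_eq_of_ne hβ, map_zero]
  · simp

lemma range_arrowSum (X : QuiverRep V A) (i : V) :
    LinearMap.range (X.arrowSum i) = X.imageSum i := by
  classical
  apply le_antisymm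
  · rintro _ ⟨x, rfl⟩
    rw [arrowSum_apply]
    exact Submodule.sum_mem _ fun α _ =>
      le_iSup (fun α : InArrow i => LinearMap.range (X.pathMap α.2.toPath)) α ⟨x α, rfl⟩
  · refine iSup_le fun α => ?_
    rintro _ ⟨x, rfl⟩
    exact ⟨Pi.single α x, arrowSum_single X α x⟩

lemma mem_imageSum_iff {X : QuiverRep V A} {i : V} {x : X.br i} :
    x ∈ X.imageSum i ↔ ∃ y, X.arrowSum i y = x := by
  rw [← range_arrowSum]; rfl

lemma arrowSum_mem (X : QuiverRep V A) {i : V} (y : ∀ α : InArrow i, X.br α.1) :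
    X.arrowSum i y ∈ X.imageSum i := mem_imageSum_iff.2 ⟨y, rfl⟩

lemma IsAddMap.arrowSum {X : QuiverRep V A} {Y : QuiverRep V B} {F : ∀ i, X.br i →+ Y.br i}
    (hF : IsAddMap X Y F) (i : V) (x : ∀ α : InArrow i, X.br α.1) :
    F i (X.arrowSum i x) = Y.arrowSum i fun α => F α.1 (x α) := by
  rw [arrowSum_apply, arrowSum_apply, map_sum]
  exact Finset.sum_congr rfl fun α _ => hF _ _ _ _

lemma homAt_arrowSum {X Y : QuiverRep V A} (f : X ⟶ Y) (i : V)
    (x : ∀ α : InArrow i, X.br α.1) :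
    homAt f i (X.arrowSum i x) = Y.arrowSum i fun α => homAt f α.1 (x α) :=
  (homAt_isAddMap f).arrowSum i x

lemma homAt_mem_imageSum {X Y : QuiverRep V A} (f : X ⟶ Y) {i : V} {x : X.br i}
    (hx : x ∈ X.imageSum i) : homAt f i x ∈ Y.imageSum i := by
  obtain ⟨y, rfl⟩ := mem_imageSum_iff.1 hx
  rw [homAt_arrowSum]
  exact arrowSum_mem _ _

lemma exists_mem_imageSum {X Y : QuiverRep V A} (f : X ⟶ Y)
    (hf : ∀ i, Function.Surjective (homAt f i)) {i : V} {y : Y.br i}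
    (hy : y ∈ Y.imageSum i) : ∃ x ∈ X.imageSum i, homAt f i x = y := by
  obtain ⟨y, rfl⟩ := mem_imageSum_iff.1 hy
  choose x hx using fun α : InArrow i => hf α.1 (y α)
  refine ⟨X.arrowSum i x, arrowSum_mem _ _, ?_⟩
  rw [homAt_arrowSum]
  simp only [hx]

/-- The first homology of `X` with coefficients in the simple modules vanishes: this is the
conjunction of the conditions (m1) and (m2). -/
def IsSeparated (I : MonomialRelations V) (X : QuiverRep V A) : Prop :=
  ∀ (i : V) (x : ∀ α : InArrow i, X.br α.1), X.arrowSum i x = 0 → ∀ α, x α ∈ X.relKernel I α.2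

/-- By (m1) a vanishing sum vanishes term by term, and (m2) describes the kernel of each arrow. -/
lemma isSeparated_of_conditions {I : MonomialRelations V} {X : QuiverRep V A}
    (h₁ : ∀ i : V, iSupIndep fun α : InArrow i => LinearMap.range (X.pathMap α.2.toPath))
    (h₂ : ∀ (j i : V) (α : j ⟶ i), LinearMap.ker (X.pathMap α.toPath) = X.relKernel I α) :
    X.IsSeparated I := by
  intro i x hx α
  rw [← h₂, LinearMap.mem_ker]
  rw [arrowSum_apply] at hx
  exact (iSupIndep_iff_finsetSum_eq_zero_imp_eq_zero _).1 (h₁ i) Finset.univ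
    (fun α => X.pathMap α.2.toPath (x α)) (fun α _ => ⟨x α, rfl⟩) hx α (Finset.mem_univ _)

lemma IsSeparated.iSupIndep {I : MonomialRelations V} {X : QuiverRep V A}
    (hX : X.IsSeparated I) (hI : X.SatisfiesRelations I) (i : V) :
    iSupIndep fun α : InArrow i => LinearMap.range (X.pathMap α.2.toPath) := by
  classical
  rw [iSupIndep_iff_finsetSum_eq_zero_imp_eq_zero]
  intro s v hv h₀ α hα
  choose! y hy using hv
  have key := hX i (fun α => if α ∈ s then y α else 0) ?_ α
  · rw [if_pos hα] at key
    rw [← hy α hα]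
    exact hI.pathMap_relKernel key
  · rw [arrowSum_apply, ← h₀]
    symm
    apply Finset.sum_subset_zero_on_sdiff (Finset.subset_univ s)
    · intro β hβ
      rw [if_neg (by simpa using hβ), map_zero]
    · intro β hβ
      rw [if_pos hβ, hy β hβ]

lemma IsSeparated.ker_eq {I : MonomialRelations V} {X : QuiverRep V A}
    (hX : X.IsSeparated I) (hI : X.SatisfiesRelations I) {j i : V} (α : j ⟶ i) :
    LinearMap.ker (X.pathMap α.toPath) = X.relKernel I α := by
  classical
  apply le_antisymm
  · intro x hx
    have := hX i (Pi.single ⟨j, α⟩ x)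
      ((arrowSum_single X (⟨j, α⟩ : InArrow i) x).trans hx) ⟨j, α⟩
    rwa [Pi.single_eq_same] at this
  · intro x hx
    exact hI.pathMap_relKernel hx

variable {I : MonomialRelations V} {X Y Z : QuiverRep V A} {f : X ⟶ Y} {g : Y ⟶ Z}

/-- A relation `y` in `Y` maps to one in `Z`, whose components lie in the kernels generated by `K_α`
and lift to such components `y'` in `Y`. The arrows kill `y'`, so `y - y'` is again a relation; it
comes from `X`, where separatedness applies. -/
lemma IsSeparated.extension (hf : ∀ i, Function.Injective (homAt f i))
    (hfg : ∀ i, Function.Exact (homAt f i) (homAt g i))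
    (hg : ∀ i, Function.Surjective (homAt g i)) (hY : Y.SatisfiesRelations I)
    (hX : X.IsSeparated I) (hZ : Z.IsSeparated I) : Y.IsSeparated I := by
  intro i y hy α
  have hz : Z.arrowSum i (fun α => homAt g α.1 (y α)) = 0 := by
    rw [← homAt_arrowSum, hy, map_zero]
  choose y' hy' hyz using fun α => (homAt_isAddMap g).exists_mem_relKernel hg (hZ i _ hz α)
  have hx : ∀ α, ∃ x, homAt f α.1 x = y α - y' α := fun α =>
    (hfg _ _).1 (by rw [map_sub, sub_eq_zero]; exact (hyz α).symm)
  choose x hx using hx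
  have hx0 : X.arrowSum i x = 0 := by
    apply hf i
    rw [homAt_arrowSum, map_zero]
    simp only [hx]
    have : Y.arrowSum i (fun α => y α - y' α) = Y.arrowSum i y - Y.arrowSum i y' :=
      map_sub (Y.arrowSum i) y y'
    rw [this, hy, zero_sub, neg_eq_zero, arrowSum_apply]
    exact Finset.sum_eq_zero fun α _ => hY.pathMap_relKernel (hy' α)
  have h₁ := (homAt_isAddMap f).mem_relKernel (hX i x hx0 α)
  have h₂ : homAt f α.1 (x α) ∈ Y.relKernel I α.2 := h₁
  rw [hx, sub_mem_comm_iff] at h₂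
  have := sub_mem (hy' α) h₂
  simpa using this

/-- Left exactness of the cokernel functor: the connecting map starts at the first homology of `Z`,
which vanishes. -/
lemma IsSeparated.mem_imageSum_of_homAt
    (hfg : ∀ i, Function.Exact (homAt f i) (homAt g i)) (hf : ∀ i, Function.Injective (homAt f i))
    (hg : ∀ i, Function.Surjective (homAt g i)) (hY : Y.SatisfiesRelations I)
    (hZ : Z.IsSeparated I) {i : V} {x : X.br i} (hx : homAt f i x ∈ Y.imageSum i) :
    x ∈ X.imageSum i := by
  obtain ⟨y, hy⟩ := mem_imageSum_iff.1 hx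
  have hz : Z.arrowSum i (fun α => homAt g α.1 (y α)) = 0 := by
    rw [← homAt_arrowSum, hy]
    exact (hfg i _).2 ⟨x, rfl⟩
  choose y' hy' hyz using fun α => (homAt_isAddMap g).exists_mem_relKernel hg (hZ i _ hz α)
  have hx : ∀ α, ∃ x, homAt f α.1 x = y α - y' α := fun α =>
    (hfg _ _).1 (by rw [map_sub, sub_eq_zero]; exact (hyz α).symm)
  choose x' hx' using hx
  refine mem_imageSum_iff.2 ⟨x', hf i ?_⟩
  rw [homAt_arrowSum, ← hy]
  simp only [hx']
  have : Y.arrowSum i (fun α => y α - y' α) = Y.arrowSum i y - Y.arrowSum i y' :=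
    map_sub (Y.arrowSum i) y y'
  rw [this, sub_eq_self, arrowSum_apply]
  exact Finset.sum_eq_zero fun α _ => hY.pathMap_relKernel (hy' α)

/-- Lift a relation in `Z` to a family `y` in `Y`. Its sum comes from `X`, and injectivity on
cokernels makes it a sum over arrows already in `X`. Subtracting that family turns `y` into a
relation in `Y`. -/
lemma IsSeparated.quotient
    (hfg : ∀ i, Function.Exact (homAt f i) (homAt g i))
    (hg : ∀ i, Function.Surjective (homAt g i)) (hY : Y.IsSeparated I)
    (hc : ∀ i x, homAt f i x ∈ Y.imageSum i → x ∈ X.imageSum i) : Z.IsSeparated I := by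
  intro i z hz α
  choose y hy using fun α : InArrow i => hg α.1 (z α)
  have h₀ : homAt g i (Y.arrowSum i y) = 0 := by
    rw [homAt_arrowSum, ← hz]
    simp only [hy]
  obtain ⟨x, hx⟩ := (hfg i _).1 h₀
  obtain ⟨x', rfl⟩ := mem_imageSum_iff.1 (hc i x (by rw [hx]; exact arrowSum_mem _ _))
  rw [homAt_arrowSum] at hx
  have h₁ : Y.arrowSum i (fun α => y α - homAt f α.1 (x' α)) = 0 := by
    have : Y.arrowSum i (fun α => y α - homAt f α.1 (x' α)) =
        Y.arrowSum i y - Y.arrowSum i (fun α => homAt f α.1 (x' α)) :=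
      map_sub (Y.arrowSum i) y _
    rw [this, hx, sub_self]
  have h₂ : homAt g α.1 _ ∈ Z.relKernel I α.2 :=
    (homAt_isAddMap g).mem_relKernel (hY i _ h₁ α)
  rwa [map_sub, hy, (hfg _ _).2 ⟨_, rfl⟩, sub_zero] at h₂

end Finite

end QuiverRep

/-! ### Finite acyclic quivers -/

section Acyclic

variable {V : Type w} [Quiver.{w'} V]

/-- A function on the vertices that increases along the arrows. -/
def IsRank (r : V → ℕ) : Prop := ∀ ⦃j i : V⦄, (j ⟶ i) → r j < r i

lemma IsAcyclicQuiver.exists_isRank [Finite V] (hV : IsAcyclicQuiver V) :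
    ∃ r : V → ℕ, IsRank r := by
  -- The rank counts the predecessors. Along `j ⟶ i` the set grows strictly: it gains `i` itself,
  -- since a path from `i` to `j` would close a cycle.
  refine ⟨fun i => Set.ncard {j : V | Nonempty (Quiver.Path j i)}, fun j i α => ?_⟩
  apply Set.ncard_lt_ncard _ (Set.toFinite _)
  refine ⟨fun h ⟨p⟩ => ⟨p.cons α⟩, fun h => ?_⟩
  obtain ⟨p⟩ := h (show Nonempty (Quiver.Path i i) from ⟨.nil⟩)
  have := hV j (α.toPath.comp p)
  rw [Quiver.Path.length_comp, Quiver.Path.length_toPath] at this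
  omega

lemma IsRank.induction {r : V → ℕ} (hr : IsRank r) {P : V → Prop}
    (h : ∀ i, (∀ j, (j ⟶ i) → P j) → P i) (i : V) : P i := by
  induction hn : r i using Nat.strong_induction_on generalizing i with
  | _ n ih => exact h i fun j α => ih (r j) (hn ▸ hr α) j rfl

lemma IsRank.exists_sink [Finite V] [Nonempty V] {r : V → ℕ} (hr : IsRank r) :
    ∃ i : V, ∀ j, IsEmpty (i ⟶ j) := by
  obtain ⟨i, hi⟩ := Finite.exists_max r
  exact ⟨i, fun j => ⟨fun α => (hr α).not_ge (hi j)⟩⟩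

lemma IsRank.finite_paths {r : V → ℕ} (hr : IsRank r) [∀ i : V, Finite (InArrow i)] (i : V) :
    Finite (Σ j : V, Quiver.Path j i) := by
  induction i using hr.induction with
  | h i ih =>
    have : ∀ α : InArrow i, Finite (Σ j : V, Quiver.Path j α.1) := fun α => ih _ α.2
    let F : Option (Σ α : InArrow i, Σ j : V, Quiver.Path j α.1) → Σ j : V, Quiver.Path j i
      | none => ⟨i, .nil⟩
      | some ⟨α, p⟩ => ⟨p.1, p.2.cons α.2⟩
    refine Finite.of_surjective F ?_
    rintro ⟨j, p⟩
    cases p with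
    | nil => exact ⟨none, rfl⟩
    | cons p α => exact ⟨some ⟨⟨_, α⟩, ⟨_, p⟩⟩, rfl⟩

/-- Choice of a family of values, where the condition on the value at a vertex depends only on
the values at the starting vertices of the arrows ending there. -/
lemma IsRank.exists_family [Finite V] {r : V → ℕ} (hr : IsRank r) {β : V → Type*}
    [∀ i, Nonempty (β i)]
    (P : ∀ i : V, β i → (∀ j, (j ⟶ i) → β j) → Prop)
    (hP : ∀ (i : V) (F : ∀ j, β j), (∀ j, r j < r i → P j (F j) fun l _ => F l) →
      ∃ b : β i, P i b fun l _ => F l) :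
    ∃ F : ∀ j, β j, ∀ i, P i (F i) fun l _ => F l := by
  classical
  have key : ∀ n : ℕ, ∃ F : ∀ j, β j, ∀ i, r i < n → P i (F i) fun l _ => F l := by
    intro n
    induction n with
    | zero => exact ⟨fun j => Classical.arbitrary _, fun i hi => absurd hi (Nat.not_lt_zero _)⟩
    | succ n ih =>
      obtain ⟨F, hF⟩ := ih
      have hstep : ∀ i, ∃ b : β i, r i = n → P i b fun l _ => F l := by
        intro i
        by_cases hi : r i = n
        · obtain ⟨b, hb⟩ := hP i F fun j hj => hF j (hi ▸ hj)
          exact ⟨b, fun _ => hb⟩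
        · exact ⟨F i, fun h => absurd h hi⟩
      choose b hb using hstep
      -- Only values of rank exactly `n` change, and the conditions at ranks up to `n` see only
      -- values of smaller rank besides the one at the vertex itself.
      let G : ∀ j, β j := fun j => if r j = n then b j else F j
      have hG : ∀ j, r j < n → G j = F j := fun j hj => if_neg hj.ne
      refine ⟨G, fun i hi => ?_⟩
      have hGi : (fun l (_ : l ⟶ i) => G l) = fun l _ => F l := by
        funext l α
        exact hG l ((hr α).trans_le (Nat.lt_succ_iff.1 hi))
      rw [hGi]
      rcases Nat.lt_succ_iff_lt_or_eq.1 hi with h | h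
      · rw [hG i h]; exact hF i h
      · have : G i = b i := if_pos h
        rw [this]; exact hb i h
  obtain ⟨n, hn⟩ := (Set.finite_range r).bddAbove
  obtain ⟨F, hF⟩ := key (n + 1)
  exact ⟨F, fun i => hF i (Nat.lt_succ_of_le (hn ⟨i, rfl⟩))⟩

end Acyclic

namespace QuiverRep

variable {V : Type w} [Quiver.{w'} V] {A : Type u} [Ring A] [∀ i : V, Fintype (InArrow i)]

/-- A form of Nakayama's lemma: the error lies in the image of the incoming arrows and is corrected
with preimages at vertices of smaller rank. -/
lemma surjective_of_cok_surjective {r : V → ℕ} (hr : IsRank r) {X Y : QuiverRep V A} (f : X ⟶ Y)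
    (h : ∀ i (y : Y.br i), ∃ x, y - homAt f i x ∈ Y.imageSum i) (i : V) :
    Function.Surjective (homAt f i) := by
  induction i using hr.induction with
  | h i ih =>
    intro y
    obtain ⟨x, hx⟩ := h i y
    obtain ⟨z, hz⟩ := mem_imageSum_iff.1 hx
    choose t ht using fun α : InArrow i => ih α.1 α.2 (z α)
    refine ⟨x + X.arrowSum i t, ?_⟩
    rw [map_add, homAt_arrowSum]
    simp only [ht]
    rw [hz]
    abel

end QuiverRep

/-! ### The representations freely generated by families of modules -/

/-- The paths ending in `j` that do not lie in the ideal. -/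
abbrev NonzeroPath {V : Type w} [Quiver.{w'} V] (I : MonomialRelations V) (j : V) :=
  {p : Σ i : V, Quiver.Path i j // ¬ I.Mem p.2}

namespace NonzeroPath

variable {V : Type w} [Quiver.{w'} V] {I : MonomialRelations V}

/-- The trivial path at a vertex. -/
def nil (I : MonomialRelations V) (i : V) : NonzeroPath I i :=
  ⟨⟨i, .nil⟩, fun h => by simpa using h.two_le_length⟩

noncomputable instance [∀ i : V, Finite (Σ j : V, Quiver.Path j i)] (j : V) :
    Fintype (NonzeroPath I j) := Fintype.ofFinite _

end NonzeroPath

namespace QuiverRep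

variable {V : Type w} [Quiver.{w'} V] {A : Type u} [Ring A]
  [∀ i : V, Finite (Σ j : V, Quiver.Path j i)] (I : MonomialRelations V)

section Branches

variable (M : V → ModuleCat.{u} A)

/-- The branch at `j` of the representation generated by `M`. -/
noncomputable def freeBr (j : V) : ModuleCat.{u} A :=
  -- The paths live in the universes of the quiver. There are finitely many, so the product is small
  -- and `Shrink` brings it back to the universe of `A`.
  ModuleCat.of A (Shrink.{u} (∀ p : NonzeroPath I j, M p.1.1))

variable {I M}

/-- A branch of the representation generated by `M` as a product. -/
noncomputable def freeEquiv (j : V) :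
    freeBr I M j ≃ₗ[A] (∀ p : NonzeroPath I j, M p.1.1) :=
  Shrink.linearEquiv.{u} A (∀ p : NonzeroPath I j, M p.1.1)

/-- The component at a path. -/
noncomputable def coord {j : V} (p : NonzeroPath I j) : freeBr I M j →ₗ[A] M p.1.1 :=
  LinearMap.proj p ∘ₗ (freeEquiv j).toLinearMap

open Classical in
/-- The inclusion of the summand of a path. -/
noncomputable def single {j : V} (p : NonzeroPath I j) : M p.1.1 →ₗ[A] freeBr I M j :=
  (freeEquiv j).symm.toLinearMap ∘ₗ
    LinearMap.single A (fun p : NonzeroPath I j => M p.1.1) p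

lemma coord_ext {j : V} {x y : freeBr I M j} (h : ∀ p : NonzeroPath I j, coord p x = coord p y) :
    x = y := by
  apply (freeEquiv j).injective
  funext p
  exact h p

lemma coord_single_same {j : V} (p : NonzeroPath I j) (m : M p.1.1) :
    coord p (single p m) = m := by
  classical
  change (freeEquiv j)
    ((freeEquiv j).symm (Pi.single p m)) p = m
  rw [LinearEquiv.apply_symm_apply, Pi.single_eq_same]

lemma coord_single_of_ne {j : V} {p q : NonzeroPath I j} (h : q ≠ p) (m : M p.1.1) :
    coord q (single p m) = 0 := by
  classical
  change (freeEquiv j)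
    ((freeEquiv j).symm (Pi.single p m)) q = 0
  rw [LinearEquiv.apply_symm_apply, Pi.single_eq_of_ne h]

lemma eq_sum_single {j : V} (x : freeBr I M j) :
    x = ∑ p : NonzeroPath I j, single p (coord p x) := by
  apply coord_ext
  intro q
  rw [map_sum, Finset.sum_eq_single q, coord_single_same]
  · intro p _ hp
    exact coord_single_of_ne hp.symm _
  · simp

lemma freeBr_hom_ext {j : V} {N : Type*} [AddCommGroup N] {F G : freeBr I M j →+ N}
    (h : ∀ (p : NonzeroPath I j) (m : M p.1.1), F (single p m) = G (single p m))
    (x : freeBr I M j) : F x = G x := by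
  rw [eq_sum_single x, map_sum, map_sum]
  exact Finset.sum_congr rfl fun p _ => h p _

/-- The map from a branch given by maps on the summands. -/
noncomputable def freeDesc {N : Type*} [AddCommGroup N] [Module A N] {j : V}
    (φ : ∀ p : NonzeroPath I j, M p.1.1 →ₗ[A] N) : freeBr I M j →ₗ[A] N :=
  ∑ p : NonzeroPath I j, φ p ∘ₗ coord p

lemma freeDesc_single {N : Type*} [AddCommGroup N] [Module A N] {j : V}
    (φ : ∀ p : NonzeroPath I j, M p.1.1 →ₗ[A] N) (p : NonzeroPath I j) (m : M p.1.1) :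
    freeDesc φ (single p m) = φ p m := by
  rw [freeDesc, LinearMap.sum_apply, Finset.sum_eq_single p]
  · rw [LinearMap.comp_apply, coord_single_same]
  · intro q _ hq
    rw [LinearMap.comp_apply, coord_single_of_ne hq, map_zero]
  · simp

lemma finite_freeBr (hM : ∀ i, Module.Finite A (M i)) (j : V) :
    Module.Finite A (freeBr I M j) :=
  Module.Finite.equiv (freeEquiv j).symm

lemma isRelativelyInjective_freeBr {𝒳 : ObjectProperty (ModuleCat.{u} A)}
    (hM : ∀ i, IsRelativelyInjective 𝒳 (M i)) (j : V) :
    IsRelativelyInjective 𝒳 (freeBr I M j) := by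
  intro N W h₁ h₂ h₃ a
  choose b hb using fun p : NonzeroPath I j => hM p.1.1 N W h₁ h₂ h₃ (coord p ∘ₗ a)
  refine ⟨∑ p : NonzeroPath I j, single p ∘ₗ b p, fun x => ?_⟩
  rw [eq_sum_single (a x), LinearMap.sum_apply]
  exact Finset.sum_congr rfl fun p _ => congrArg (single p) (hb p x)

end Branches

variable (M : V → ModuleCat.{u} A)

open Classical in
/-- The map along an arrow. -/
noncomputable def freeArrow {j i : V} (α : j ⟶ i) : freeBr I M j →ₗ[A] freeBr I M i :=
  freeDesc fun p => if h : I.Mem (p.1.2.cons α) then 0 else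
    single (M := M) (⟨⟨p.1.1, p.1.2.cons α⟩, h⟩ : NonzeroPath I i)

/-- The representation generated by a family of modules at the vertices. -/
noncomputable def freeRep : QuiverRep V A :=
  mkRep (freeBr I M) fun _ _ α => freeArrow I M α

variable {I M}

/-- The component of an element of a branch at a path. -/
noncomputable def freeCoord {j : V} (p : NonzeroPath I j) : (freeRep I M).br j →ₗ[A] M p.1.1 :=
  coord p

/-- The inclusion of the summand of a path in a branch. -/
noncomputable def freeSingle {j : V} (p : NonzeroPath I j) :
    M p.1.1 →ₗ[A] (freeRep I M).br j :=
  single p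

lemma freeArrow_single_of_mem {j i : V} (α : j ⟶ i) (p : NonzeroPath I j) (m : M p.1.1)
    (h : I.Mem (p.1.2.cons α)) : freeArrow I M α (single p m) = 0 := by
  rw [freeArrow, freeDesc_single, dif_pos h, LinearMap.zero_apply]

lemma freeArrow_single {j i : V} (α : j ⟶ i) (p : NonzeroPath I j) (m : M p.1.1)
    (h : ¬ I.Mem (p.1.2.cons α)) : freeArrow I M α (single p m) =
      single (M := M) (⟨⟨p.1.1, p.1.2.cons α⟩, h⟩ : NonzeroPath I i) m := by
  rw [freeArrow, freeDesc_single, dif_neg h]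

lemma toPath_freeSingle_of_mem {j i : V} (α : j ⟶ i) (p : NonzeroPath I j) (m : M p.1.1)
    (h : I.Mem (p.1.2.cons α)) : (freeRep I M).pathMap α.toPath (freeSingle p m) = 0 :=
  (mkRep_pathMap_toPath _ _ α _).trans (freeArrow_single_of_mem α p m h)

lemma toPath_freeSingle {j i : V} (α : j ⟶ i) (p : NonzeroPath I j) (m : M p.1.1)
    (h : ¬ I.Mem (p.1.2.cons α)) :
    (freeRep I M).pathMap α.toPath (freeSingle p m) =
      freeSingle (M := M) (⟨⟨p.1.1, p.1.2.cons α⟩, h⟩ : NonzeroPath I i) m :=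
  (mkRep_pathMap_toPath _ _ α _).trans (freeArrow_single α p m h)

lemma pathMap_freeSingle {j i : V} (q : Quiver.Path j i) (p : NonzeroPath I j) (m : M p.1.1)
    (h : ¬ I.Mem (p.1.2.comp q)) :
    (freeRep I M).pathMap q (freeSingle p m) =
      freeSingle (M := M) (⟨⟨p.1.1, p.1.2.comp q⟩, h⟩ : NonzeroPath I i) m := by
  induction q with
  | nil => rw [pathMap_nil]; rfl
  | cons q α ih =>
    have h' : ¬ I.Mem (p.1.2.comp q) := fun h' => h (h'.comp_right α.toPath)
    rw [pathMap_cons_apply, ih h']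
    exact toPath_freeSingle α ⟨⟨p.1.1, p.1.2.comp q⟩, h'⟩ m h

lemma pathMap_freeSingle_of_mem {j i : V} (q : Quiver.Path j i) (p : NonzeroPath I j)
    (m : M p.1.1) (h : I.Mem (p.1.2.comp q)) :
    (freeRep I M).pathMap q (freeSingle p m) = 0 := by
  induction q with
  | nil => exact absurd h p.2
  | cons q α ih =>
    rw [pathMap_cons_apply]
    by_cases h' : I.Mem (p.1.2.comp q)
    · rw [ih h', map_zero]
    · rw [pathMap_freeSingle q p m h']
      exact toPath_freeSingle_of_mem α ⟨⟨p.1.1, p.1.2.comp q⟩, h'⟩ m h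

lemma freeCoord_single_same {j : V} (p : NonzeroPath I j) (m : M p.1.1) :
    freeCoord p (freeSingle p m) = m := coord_single_same p m

lemma freeCoord_single_of_ne {j : V} {p q : NonzeroPath I j} (h : q ≠ p) (m : M p.1.1) :
    freeCoord q (freeSingle p m) = 0 := coord_single_of_ne h m

lemma freeCoord_ext {j : V} {x y : (freeRep I M).br j}
    (h : ∀ p : NonzeroPath I j, freeCoord p x = freeCoord p y) : x = y := coord_ext h

lemma eq_sum_freeSingle {j : V} (x : (freeRep I M).br j) :
    x = ∑ p : NonzeroPath I j, freeSingle p (freeCoord p x) := eq_sum_single x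

lemma freeRep_hom_ext {j : V} {N : Type*} [AddCommGroup N] {F G : (freeRep I M).br j →+ N}
    (h : ∀ (p : NonzeroPath I j) (m : M p.1.1), F (freeSingle p m) = G (freeSingle p m))
    (x : (freeRep I M).br j) : F x = G x := freeBr_hom_ext h x

lemma freeRep_satisfiesRelations : (freeRep I M).SatisfiesRelations I := by
  intro i j p hp
  ext x
  refine freeRep_hom_ext (F := ((freeRep I M).pathMap p).toAddMonoidHom) (G := 0)
    (fun q m => ?_) x
  exact pathMap_freeSingle_of_mem p q m ((MonomialRelations.Mem.of_rel hp).comp_left _)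

/-- Paths cancel on the right, so `p` is the only path whose continuation by `q` contributes to this
coordinate. -/
lemma freeCoord_comp_pathMap {j i : V} (q : Quiver.Path j i) (p : NonzeroPath I j)
    (h : ¬ I.Mem (p.1.2.comp q)) (x : (freeRep I M).br j) :
    freeCoord (M := M) (⟨⟨p.1.1, p.1.2.comp q⟩, h⟩ : NonzeroPath I i)
      ((freeRep I M).pathMap q x) = freeCoord p x := by
  refine freeRep_hom_ext (F := (freeCoord (M := M)
    (⟨⟨p.1.1, p.1.2.comp q⟩, h⟩ : NonzeroPath I i) ∘ₗ
      (freeRep I M).pathMap q).toAddMonoidHom) (G := (freeCoord p).toAddMonoidHom)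
    (fun p' m => ?_) x
  change freeCoord (M := M) (⟨⟨p.1.1, p.1.2.comp q⟩, h⟩ : NonzeroPath I i)
    ((freeRep I M).pathMap q (freeSingle p' m)) = freeCoord p (freeSingle p' m)
  by_cases hp : p = p'
  · subst hp
    rw [pathMap_freeSingle q p m h, freeCoord_single_same, freeCoord_single_same]
  · rw [freeCoord_single_of_ne hp]
    by_cases h' : I.Mem (p'.1.2.comp q)
    · rw [pathMap_freeSingle_of_mem q p' m h', map_zero]
    · rw [pathMap_freeSingle q p' m h']
      apply freeCoord_single_of_ne
      intro he
      apply hp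
      obtain ⟨⟨a, p⟩, hp₁⟩ := p
      obtain ⟨⟨b, p'⟩, hp₂⟩ := p'
      have he := congrArg Subtype.val he
      obtain ⟨rfl, he'⟩ := Sigma.mk.inj_iff.1 he
      simp only [heq_eq_eq, Quiver.Path.comp_inj_left] at he'
      subst he'
      rfl

lemma freeCoord_pathMap_of_ne {j i : V} (q : Quiver.Path j i) (p : NonzeroPath I i)
    (h : ∀ p' : Quiver.Path p.1.1 j, p.1.2 ≠ p'.comp q) (x : (freeRep I M).br j) :
    freeCoord p ((freeRep I M).pathMap q x) = 0 := by
  refine freeRep_hom_ext (F := (freeCoord p ∘ₗ (freeRep I M).pathMap q).toAddMonoidHom) (G := 0)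
    (fun p' m => ?_) x
  change freeCoord _ ((freeRep I M).pathMap q (freeSingle p' m)) = 0
  by_cases h' : I.Mem (p'.1.2.comp q)
  · rw [pathMap_freeSingle_of_mem q p' m h', map_zero]
  · rw [pathMap_freeSingle q p' m h']
    apply freeCoord_single_of_ne
    intro he
    subst he
    exact h p'.1.2 rfl

/-- The component at the trivial path. -/
noncomputable abbrev freeTop (i : V) : (freeRep I M).br i →ₗ[A] M i :=
  freeCoord (NonzeroPath.nil I i)

/-- The inclusion of the generators. -/
noncomputable abbrev freeGen (i : V) : M i →ₗ[A] (freeRep I M).br i :=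
  freeSingle (NonzeroPath.nil I i)

lemma freeTop_gen {i : V} (m : M i) : freeTop (I := I) (M := M) i (freeGen i m) = m :=
  freeCoord_single_same (NonzeroPath.nil I i) m

lemma freeTop_surjective (i : V) : Function.Surjective (freeTop (I := I) (M := M) i) :=
  fun m => ⟨_, freeTop_gen m⟩

lemma pathMap_freeGen {i : V} (p : NonzeroPath I i) (m : M p.1.1) :
    (freeRep I M).pathMap p.1.2 (freeGen p.1.1 m) = freeSingle p m := by
  obtain ⟨⟨a, p⟩, hp⟩ := p
  have aux : ∀ (q : Quiver.Path a i) (hq : ¬ I.Mem q), q = p →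
      freeSingle (M := M) (⟨⟨a, q⟩, hq⟩ : NonzeroPath I i) m =
        freeSingle (M := M) (⟨⟨a, p⟩, hp⟩ : NonzeroPath I i) m := by
    rintro _ _ rfl; rfl
  have h : ¬ I.Mem (Quiver.Path.nil.comp p) := by rwa [Quiver.Path.nil_comp]
  exact (pathMap_freeSingle p (NonzeroPath.nil I a) m h).trans
    (aux _ h (Quiver.Path.nil_comp p))

/-- The homomorphism from the generated representation determined by maps on the generators. -/
noncomputable def freeHom {X : QuiverRep V A} (hX : X.SatisfiesRelations I)
    (φ : ∀ i, M i →ₗ[A] X.br i) : freeRep I M ⟶ X :=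
  mkHom (X := freeRep I M) (fun j => freeDesc (j := j) fun p => X.pathMap p.1.2 ∘ₗ φ p.1.1) (by
    intro j i α x
    refine freeRep_hom_ext
      (F := ((freeDesc (j := i) fun p => X.pathMap p.1.2 ∘ₗ φ p.1.1) ∘ₗ
        (freeRep I M).pathMap α.toPath).toAddMonoidHom)
      (G := (X.pathMap α.toPath ∘ₗ
        freeDesc (j := j) fun p => X.pathMap p.1.2 ∘ₗ φ p.1.1).toAddMonoidHom) (fun p m => ?_) x
    change freeDesc (j := i) (fun p => X.pathMap p.1.2 ∘ₗ φ p.1.1)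
        ((freeRep I M).pathMap α.toPath (freeSingle p m)) =
      X.pathMap α.toPath (freeDesc (j := j) (fun p => X.pathMap p.1.2 ∘ₗ φ p.1.1) (single p m))
    rw [freeDesc_single, LinearMap.comp_apply, ← pathMap_cons_apply]
    by_cases h : I.Mem (p.1.2.cons α)
    · rw [hX.pathMap_eq_zero h]
      exact (congrArg (freeDesc (j := i) fun p => X.pathMap p.1.2 ∘ₗ φ p.1.1)
        (toPath_freeSingle_of_mem α p m h)).trans (map_zero _)
    · rw [toPath_freeSingle α p m h]
      exact freeDesc_single (M := M) _ (⟨⟨p.1.1, p.1.2.cons α⟩, h⟩ : NonzeroPath I i) m)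

lemma freeHom_single {X : QuiverRep V A} (hX : X.SatisfiesRelations I)
    (φ : ∀ i, M i →ₗ[A] X.br i) {j : V} (p : NonzeroPath I j) (m : M p.1.1) :
    homAt (freeHom hX φ) j (freeSingle p m) = X.pathMap p.1.2 (φ p.1.1 m) :=
  freeDesc_single _ p m

lemma freeHom_gen {X : QuiverRep V A} (hX : X.SatisfiesRelations I)
    (φ : ∀ i, M i →ₗ[A] X.br i) {i : V} (m : M i) :
    homAt (freeHom hX φ) i (freeGen i m) = φ i m := by
  refine (freeHom_single hX φ (NonzeroPath.nil I i) m).trans ?_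
  change X.pathMap Quiver.Path.nil (φ i m) = _
  rw [pathMap_nil]; rfl

lemma freeRep_homs_ext {X : QuiverRep V A} {f g : freeRep I M ⟶ X}
    (h : ∀ i (m : M i), homAt f i (freeGen i m) = homAt g i (freeGen i m)) : f = g := by
  apply hom_ext
  intro j x
  refine freeRep_hom_ext (F := (homAt f j).toAddMonoidHom) (G := (homAt g j).toAddMonoidHom)
    (fun p m => ?_) x
  change homAt f j (freeSingle p m) = homAt g j (freeSingle p m)
  rw [← pathMap_freeGen, homAt_pathMap, homAt_pathMap, h]

section Finite

variable [∀ i : V, Fintype (InArrow i)]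

/-- Every nontrivial path has a last arrow and the trivial path has none. Thus the cokernel at `i`
is `M i`. -/
lemma freeTop_eq_zero_iff {i : V} {x : (freeRep I M).br i} :
    freeTop i x = 0 ↔ x ∈ (freeRep I M).imageSum i := by
  constructor
  · intro h
    rw [eq_sum_freeSingle x]
    refine Submodule.sum_mem _ fun p _ => ?_
    obtain ⟨⟨a, p⟩, hp⟩ := p
    cases p with
    | nil =>
      change freeGen i (freeTop i x) ∈ _
      rw [h, map_zero]
      exact zero_mem _
    | cons p α =>
      have hp' : ¬ I.Mem p := fun h => hp (h.comp_right α.toPath)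
      have := toPath_freeSingle (I := I) (M := M) α ⟨⟨a, p⟩, hp'⟩
        (freeCoord ⟨⟨a, p.cons α⟩, hp⟩ x) hp
      exact this ▸ pathMap_mem_imageSum _ α _
  · intro h
    obtain ⟨y, rfl⟩ := mem_imageSum_iff.1 h
    rw [arrowSum_apply, map_sum]
    refine Finset.sum_eq_zero fun α _ => freeCoord_pathMap_of_ne _ _ (fun p' h => ?_) _
    exact Quiver.Path.nil_ne_cons _ _ h

lemma sub_freeGen_mem {i : V} (x : (freeRep I M).br i) :
    x - freeGen i (freeTop i x) ∈ (freeRep I M).imageSum i := by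
  rw [← freeTop_eq_zero_iff, map_sub, freeTop_gen, sub_self]

/-- Continuations by different arrows are different paths, so nothing cancels in a relation: `x α`
is supported on paths `p` whose continuation by `α` is in the ideal. Since elements of the ideal
have length at least two, such a `p` is nontrivial and belongs to `K_α`. -/
lemma freeRep_isSeparated : (freeRep I M).IsSeparated I := by
  intro i x hx α
  have key : ∀ p : NonzeroPath I α.1, ¬ I.Mem (p.1.2.cons α.2) → freeCoord p (x α) = 0 := by
    intro p hp
    have h := congrArg (freeCoord (M := M) (⟨⟨p.1.1, p.1.2.cons α.2⟩, hp⟩ : NonzeroPath I i)) hx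
    rw [map_zero, arrowSum_apply, map_sum, Finset.sum_eq_single α] at h
    · rw [← h]
      exact (freeCoord_comp_pathMap α.2.toPath p hp (x α)).symm
    · intro β _ hβ
      refine freeCoord_pathMap_of_ne _ _ (fun p' h => hβ ?_) _
      have h : p.1.2.cons α.2 = p'.cons β.2 := h
      have h₁ := Quiver.Path.obj_eq_of_cons_eq_cons h
      have h₂ := Quiver.Path.hom_heq_of_cons_eq_cons h
      exact (Sigma.ext h₁ h₂).symm
    · simp
  rw [eq_sum_freeSingle (x α)]
  refine Submodule.sum_mem _ fun p _ => ?_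
  by_cases hp : I.Mem (p.1.2.cons α.2)
  · rw [← pathMap_freeGen]
    refine pathMap_mem_relKernel I _ α.2 ⟨?_, p.2, hp⟩ _
    have := hp.two_le_length
    rw [Quiver.Path.length_cons] at this
    omega
  · rw [key p hp, map_zero]
    exact zero_mem _

end Finite

end QuiverRep

/-! ### Separated representations over a field are free -/

namespace QuiverRep

variable {V : Type w} [Quiver.{w'} V] {I : MonomialRelations V}

section Retracts

variable {A : Type u} [Ring A] {B : Type u} [Ring B] {X : QuiverRep V A} {Y : QuiverRep V B}
  {F : ∀ i, X.br i →+ Y.br i} {G : ∀ i, Y.br i →+ X.br i}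

lemma SatisfiesRelations.of_injective (hX : X.SatisfiesRelations I) (hG : IsAddMap Y X G)
    (h : ∀ i, Function.Injective (G i)) : Y.SatisfiesRelations I := by
  intro i j p hp
  ext y
  apply h j
  rw [hG.pathMap, hX i j p hp]
  exact (map_zero (G j)).symm

lemma SatisfiesRelations.of_surjective (hX : X.SatisfiesRelations I) (hF : IsAddMap X Y F)
    (h : ∀ i, Function.Surjective (F i)) : Y.SatisfiesRelations I := by
  intro i j p hp
  ext y
  obtain ⟨x, rfl⟩ := h i y
  rw [← hF.pathMap, hX i j p hp]
  exact map_zero (F j)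

/-- The two representations may be over different rings and the maps need only be additive. This
allows splittings over the base field to be used for representations over `A`. -/
lemma IsSeparated.of_retract [∀ i : V, Fintype (InArrow i)] (hX : X.IsSeparated I)
    (hF : IsAddMap X Y F) (hG : IsAddMap Y X G)
    (h : ∀ i y, F i (G i y) = y) : Y.IsSeparated I := by
  intro i y hy α
  have h₀ : X.arrowSum i (fun α => G α.1 (y α)) = 0 := by
    rw [← hG.arrowSum, hy, map_zero]
  have := hF.mem_relKernel (hX i _ h₀ α)
  rwa [h] at this

end Retracts

/-! ### Freeness over a field. -/

section Field

variable {k : Type u} [Field k] [∀ i : V, Fintype (InArrow i)]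
  [∀ i : V, Finite (Σ j : V, Quiver.Path j i)]

/-- Linear sections of the projections to the cokernels generate `X`, by the Nakayama argument. An
element `t` of the kernel has zero top component, so `t` is a sum over arrows of some `y α`.
Separatedness of `X` provides elements with the same images as the `y α` that are killed by the
arrows, and injectivity at smaller rank identifies them with the `y α`. -/
lemma IsSeparated.exists_free {r : V → ℕ} (hr : IsRank r) {X : QuiverRep V k}
    (hX : X.IsSeparated I) (hI : X.SatisfiesRelations I) :
    ∃ (C : V → ModuleCat.{u} k) (f : freeRep I C ⟶ X), ∀ i, Function.Bijective (homAt f i) := by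
  let C : V → ModuleCat.{u} k := X.cok
  have hs : ∀ i, ∃ s : C i →ₗ[k] X.br i, X.cokπ i ∘ₗ s = LinearMap.id := fun i =>
    LinearMap.exists_rightInverse_of_surjective _ (LinearMap.range_eq_top.2 (X.cokπ_surjective i))
  choose s hs using hs
  have hsq : ∀ i (c : C i), X.cokπ i (s i c) = c := fun i c => LinearMap.congr_fun (hs i) c
  obtain ⟨f, hfgen⟩ : ∃ f : freeRep I C ⟶ X, ∀ i (c : C i), homAt f i (freeGen i c) = s i c :=
    ⟨freeHom hI s, fun i c => freeHom_gen hI s c⟩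
  have hf : ∀ i, Function.Surjective (homAt f i) := by
    refine surjective_of_cok_surjective hr f fun i x => ⟨freeGen i (X.cokπ i x), ?_⟩
    rw [hfgen, ← cokπ_eq_zero_iff, map_sub, hsq, sub_self]
  refine ⟨C, f, fun i => ⟨?_, hf i⟩⟩
  have hker : ∀ i t, homAt f i t = 0 → t ∈ (freeRep I C).imageSum i := by
    intro i t ht
    rw [← freeTop_eq_zero_iff, ← hsq i (freeTop i t)]
    have h₁ := homAt_mem_imageSum f (sub_freeGen_mem t)
    rwa [map_sub, ht, hfgen, zero_sub, neg_mem_iff, ← cokπ_eq_zero_iff] at h₁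
  induction i using hr.induction with
  | h i ih =>
    rw [injective_iff_map_eq_zero]
    intro t ht
    obtain ⟨y, rfl⟩ := mem_imageSum_iff.1 (hker i t ht)
    rw [homAt_arrowSum] at ht
    choose z hz hzy using fun α =>
      (homAt_isAddMap f).exists_mem_relKernel hf (hX i _ ht α)
    rw [arrowSum_apply]
    refine Finset.sum_eq_zero fun α _ => ?_
    have : z α = y α := ih α.1 α.2 (hzy α)
    rw [← this]
    exact freeRep_satisfiesRelations.pathMap_relKernel (hz α)

end Field

/-! ### Consequences over an algebra of splitting over its base field. -/

section Algebra

variable {A : Type u} [Ring A]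

/-- The underlying representation over the base field. -/
noncomputable abbrev restrict (k : Type u) [Field k] [Algebra k A] (X : QuiverRep V A) :
    QuiverRep V k :=
  X ⋙ ModuleCat.restrictScalars (algebraMap k A)

lemma restrict_isAddMap (k : Type u) [Field k] [Algebra k A] (X : QuiverRep V A) :
    IsAddMap X (X.restrict k) fun i => AddMonoidHom.id (X.br i) := fun _ _ _ _ => rfl

lemma isAddMap_restrict (k : Type u) [Field k] [Algebra k A] (X : QuiverRep V A) :
    IsAddMap (X.restrict k) X fun i => AddMonoidHom.id (X.br i) := fun _ _ _ _ => rfl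

variable [∀ i : V, Fintype (InArrow i)]

lemma restrict_arrowSum (k : Type u) [Field k] [Algebra k A] (X : QuiverRep V A) (i : V)
    (x : ∀ α : InArrow i, X.br α.1) : (X.restrict k).arrowSum i x = X.arrowSum i x :=
  (X.isAddMap_restrict k).arrowSum i x

variable [∀ i : V, Finite (Σ j : V, Quiver.Path j i)]

lemma IsSeparated.exists_free_restrict (k : Type u) [Field k] [Algebra k A] {r : V → ℕ}
    (hr : IsRank r) {X : QuiverRep V A}
    (hX : X.IsSeparated I) (hI : X.SatisfiesRelations I) :
    ∃ (C : V → ModuleCat.{u} k) (f : freeRep I C ⟶ X.restrict k),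
      ∀ i, Function.Bijective (homAt f i) :=
  IsSeparated.exists_free hr
    (hX.of_retract (X.restrict_isAddMap k) (X.isAddMap_restrict k) fun _ _ => rfl)
    (hI.of_injective (X.isAddMap_restrict k) fun _ => Function.injective_id)

/-- Over `k` the target is free on vector spaces, hence maps out of it lift. The resulting section
commutes with arrows but need not be `A`-linear. -/
lemma IsSeparated.exists_addSection (k : Type u) [Field k] [Algebra k A] {r : V → ℕ}
    (hr : IsRank r) {X Y : QuiverRep V A}
    (hX : X.IsSeparated I) (hI : X.SatisfiesRelations I) (hY : Y.SatisfiesRelations I)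
    (g : Y ⟶ X) (hg : ∀ i, Function.Surjective (homAt g i)) :
    ∃ σ : ∀ i, X.br i →+ Y.br i, IsAddMap X Y σ ∧ ∀ i x, homAt g i (σ i x) = x := by
  obtain ⟨C, f, hf⟩ := hX.exists_free_restrict k hr hI
  let gk : Y.restrict k ⟶ X.restrict k := Functor.whiskerRight g _
  choose s hs using fun i => LinearMap.exists_rightInverse_of_surjective
    (homAt gk i) (LinearMap.range_eq_top.2 (hg i))
  let h : freeRep I C ⟶ Y.restrict k := freeHom (M := C)
    (hY.of_injective (Y.isAddMap_restrict k) fun _ => Function.injective_id)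
    fun i => s i ∘ₗ homAt f i ∘ₗ freeGen i
  have hhg : h ≫ gk = f := by
    refine freeRep_homs_ext fun i m => ?_
    rw [homAt_comp, freeHom_gen]
    exact LinearMap.congr_fun (hs i) _
  let e : ∀ i, (freeRep I C).br i ≃ₗ[k] (X.restrict k).br i := fun i =>
    LinearEquiv.ofBijective (homAt f i) (hf i)
  refine ⟨fun i => ((homAt h i).toAddMonoidHom.comp (e i).symm.toLinearMap.toAddMonoidHom),
    fun i j α x => ?_, fun i x => ?_⟩
  · have h₁ : (e j).symm ((X.restrict k).pathMap α.toPath x) =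
        (freeRep I C).pathMap α.toPath ((e i).symm x) := by
      rw [LinearEquiv.symm_apply_eq]
      refine Eq.trans ?_ (homAt_pathMap f α.toPath ((e i).symm x)).symm
      exact congrArg _ ((e i).apply_symm_apply x).symm
    exact (congrArg (homAt h j) h₁).trans (homAt_pathMap h α.toPath ((e i).symm x))
  · have h₁ : homAt gk i (homAt h i ((e i).symm x)) = homAt f i ((e i).symm x) := by
      rw [← homAt_comp, hhg]
    exact h₁.trans ((e i).apply_symm_apply x)

variable {X Y Z : QuiverRep V A} {f : X ⟶ Y} {g : Y ⟶ Z}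

/-- `ρ = 1 - σ g` for an additive section `σ` of `g`. It takes values in `Y` and not in `X` because
`f` is not assumed to be injective here. -/
lemma IsSeparated.exists_addRetraction (k : Type u) [Field k] [Algebra k A] {r : V → ℕ}
    (hr : IsRank r)
    (hfg : ∀ i, Function.Exact (homAt f i) (homAt g i))
    (hg : ∀ i, Function.Surjective (homAt g i)) (hY : Y.SatisfiesRelations I)
    (hZ : Z.IsSeparated I) :
    ∃ ρ : ∀ i, Y.br i →+ Y.br i, IsAddMap Y Y ρ ∧ (∀ i x, ρ i (homAt f i x) = homAt f i x) ∧
      ∀ i y, ∃ x, homAt f i x = ρ i y := by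
  obtain ⟨σ, hσ, hgσ⟩ := hZ.exists_addSection k hr
    (hY.of_surjective (homAt_isAddMap g) hg) hY g hg
  refine ⟨fun i => AddMonoidHom.id _ - (σ i).comp (homAt g i).toAddMonoidHom, ?_, ?_, ?_⟩
  · intro i j α y
    change Y.pathMap α.toPath y - σ j (homAt g j (Y.pathMap α.toPath y)) =
      Y.pathMap α.toPath (y - σ i (homAt g i y))
    rw [homAt_pathMap, hσ, map_sub]
  · intro i x
    change homAt f i x - σ i (homAt g i (homAt f i x)) = homAt f i x
    rw [(hfg i _).2 ⟨x, rfl⟩, map_zero, sub_zero]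
  · intro i y
    refine (hfg i _).1 ?_
    change homAt g i (y - σ i (homAt g i y)) = 0
    rw [map_sub, hgσ, sub_self]

/-- Once scalars are forgotten, `X` is a retract of `Y`. -/
lemma IsSeparated.kernel (k : Type u) [Field k] [Algebra k A] {r : V → ℕ}
    (hr : IsRank r)
    (hf : ∀ i, Function.Injective (homAt f i))
    (hfg : ∀ i, Function.Exact (homAt f i) (homAt g i))
    (hg : ∀ i, Function.Surjective (homAt g i)) (hI : Y.SatisfiesRelations I)
    (hY : Y.IsSeparated I) (hZ : Z.IsSeparated I) : X.IsSeparated I := by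
  obtain ⟨ρ, hρ, hρf, hρi⟩ := hZ.exists_addRetraction k hr hfg hg hI
  choose τ hτ using hρi
  refine hY.of_retract (F := fun i => AddMonoidHom.mk' (τ i) fun a b => hf i ?_) ?_
    (homAt_isAddMap f) ?_
  · rw [hτ, map_add, map_add, hτ, hτ]
  · intro i j α y
    apply hf j
    rw [homAt_pathMap]
    exact (hτ j _).trans ((hρ i j α y).trans (congrArg _ (hτ i y).symm))
  · intro i x
    exact hf i ((hτ i _).trans (hρf i x))

/-- The cokernel of `f` is separated, so there is an additive projection `ρ` of `Y` onto the image
of `f`. An element killed by `f` is a sum over arrows of some `y α`, and the `f (y α)` lie in the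
kernels generated by `K_α` in `Y`. Applying `ρ` lifts them to the corresponding kernels in `X`; by
injectivity at smaller rank the lifts are the `y α`, which the arrows therefore kill. -/
lemma IsSeparated.injective_of_cok_injective (k : Type u) [Field k] [Algebra k A] {r : V → ℕ}
    (hr : IsRank r)
    (hXI : X.SatisfiesRelations I) (hI : Y.SatisfiesRelations I)
    (hY : Y.IsSeparated I)
    (hc : ∀ i x, homAt f i x ∈ Y.imageSum i → x ∈ X.imageSum i) (i : V) :
    Function.Injective (homAt f i) := by
  have hg : ∀ i, Function.Surjective (homAt (cokernel.π f) i) := surjective_of_epi _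
  have hfg : ∀ i, Function.Exact (homAt f i) (homAt (cokernel.π f) i) :=
    exactAt_of_exact (S := ShortComplex.mk f (cokernel.π f) (cokernel.condition f))
      (ShortComplex.exact_cokernel f)
  have hZ := hY.quotient hfg hg hc
  obtain ⟨ρ, hρ, hρf, hρi⟩ := hZ.exists_addRetraction k hr hfg hg hI
  have key : ∀ {j i : V} (α : j ⟶ i) (y : Y.br j), y ∈ Y.relKernel I α →
      ∃ x ∈ X.relKernel I α, homAt f j x = ρ j y := by
    intro j i α y hy
    refine relKernel_induction (P := fun y => ∃ x ∈ X.relKernel I α, homAt f j x = ρ j y)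
      ?_ ?_ ?_ hy
    · exact ⟨0, zero_mem _, by rw [map_zero, map_zero]⟩
    · rintro y₁ y₂ ⟨x₁, h₁, e₁⟩ ⟨x₂, h₂, e₂⟩
      exact ⟨x₁ + x₂, add_mem h₁ h₂, by rw [map_add, map_add, e₁, e₂]⟩
    · intro h p hp y
      obtain ⟨x, hx⟩ := hρi h y
      exact ⟨X.pathMap p x, pathMap_mem_relKernel I X α hp x, by
        rw [homAt_pathMap, hρ.pathMap, hx]⟩
  induction i using hr.induction with
  | h i ih =>
    rw [injective_iff_map_eq_zero]
    intro t ht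
    obtain ⟨y, rfl⟩ := mem_imageSum_iff.1 (hc i t (by rw [ht]; exact zero_mem _))
    rw [homAt_arrowSum] at ht
    choose z hz hzy using fun α : InArrow i => key α.2 _ (hY i _ ht α)
    rw [arrowSum_apply]
    refine Finset.sum_eq_zero fun α _ => ?_
    have : z α = y α := ih α.1 α.2 (by rw [hzy, hρf])
    rw [← this]
    exact hXI.pathMap_relKernel (hz α)

/-- In the free model over `k`, a path outside the ideal is injective on the summand of the trivial
path, so the top component of `x` vanishes. -/
lemma IsSeparated.ker_pathMap_le (k : Type u) [Field k] [Algebra k A] {r : V → ℕ}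
    (hr : IsRank r) (hX : X.IsSeparated I)
    (hI : X.SatisfiesRelations I) {i j : V} {p : Quiver.Path i j} (hp : ¬ I.Mem p) {x : X.br i}
    (hx : X.pathMap p x = 0) : x ∈ X.imageSum i := by
  obtain ⟨C, f, hf⟩ := hX.exists_free_restrict k hr hI
  obtain ⟨t, rfl⟩ := (hf i).2 x
  have h₀ : homAt f j ((freeRep I C).pathMap p t) = 0 := (homAt_pathMap f p t).trans hx
  have h₁ := (injective_iff_map_eq_zero _).1 (hf j).1 _ h₀
  have hp' : ¬ I.Mem ((NonzeroPath.nil I i).1.2.comp p) := by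
    change ¬ I.Mem (Quiver.Path.nil.comp p)
    rwa [Quiver.Path.nil_comp]
  have h₂ := freeCoord_comp_pathMap (M := C) p (NonzeroPath.nil I i) hp' t
  rw [h₁, map_zero] at h₂
  obtain ⟨y, hy⟩ := mem_imageSum_iff.1 (freeTop_eq_zero_iff.1 h₂.symm)
  subst hy
  rw [homAt_arrowSum]
  exact mem_imageSum_iff.2 ⟨fun α => homAt f α.1 (y α), (restrict_arrowSum k X i _).symm⟩

/-- In the free model, the images along `α` followed by `p` have disjoint supports for different
`α`: the arrow preceding `p` can be read off from the path. -/
lemma IsSeparated.pathMap_eq_zero_of_sum (k : Type u) [Field k] [Algebra k A] {r : V → ℕ}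
    (hr : IsRank r) (hX : X.IsSeparated I)
    (hI : X.SatisfiesRelations I) {i j : V} (p : Quiver.Path i j)
    (x : ∀ α : InArrow i, X.br α.1) (hx : X.pathMap p (X.arrowSum i x) = 0) (α : InArrow i) :
    X.pathMap p (X.pathMap α.2.toPath (x α)) = 0 := by
  obtain ⟨C, f, hf⟩ := hX.exists_free_restrict k hr hI
  choose t ht using fun α : InArrow i => (hf α.1).2 (x α)
  have hxt : X.arrowSum i x = homAt f i ((freeRep I C).arrowSum i t) := by
    rw [homAt_arrowSum]
    refine Eq.trans ?_ (restrict_arrowSum k X i _).symm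
    exact congrArg _ (funext fun α => (ht α).symm)
  have h₀ : homAt f j ((freeRep I C).pathMap p ((freeRep I C).arrowSum i t)) = 0 :=
    (homAt_pathMap f p _).trans (hxt ▸ hx :)
  have h₁ := (injective_iff_map_eq_zero _).1 (hf j).1 _ h₀
  suffices h : (freeRep I C).pathMap p ((freeRep I C).pathMap α.2.toPath (t α)) = 0 by
    have h₂ := congrArg (homAt f j) h
    rw [map_zero, homAt_pathMap, homAt_pathMap, ht] at h₂
    exact h₂
  apply freeCoord_ext
  intro q
  rw [map_zero, ← pathMap_comp_apply]
  by_cases hq : ∃ p' : Quiver.Path q.1.1 α.1, q.1.2 = p'.comp (α.2.toPath.comp p)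
  · obtain ⟨⟨a, q⟩, hq'⟩ := q
    change ∃ p' : Quiver.Path a α.1, q = p'.comp (α.2.toPath.comp p) at hq
    obtain ⟨p', rfl⟩ := hq
    rw [← map_zero (freeCoord (M := C) ⟨⟨a, _⟩, hq'⟩), ← h₁, arrowSum_apply, map_sum, map_sum,
      Finset.sum_eq_single α]
    · rw [pathMap_comp_apply]
    · intro β _ hβ
      rw [← pathMap_comp_apply]
      refine freeCoord_pathMap_of_ne _ _ (fun (p'' : Quiver.Path a β.1)
        (h : p'.comp (α.2.toPath.comp p) = p''.comp (β.2.toPath.comp p)) => hβ ?_) _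
      rw [← Quiver.Path.comp_assoc, ← Quiver.Path.comp_assoc, Quiver.Path.comp_inj_left] at h
      have h : p'.cons α.2 = p''.cons β.2 := h
      exact (Sigma.ext (Quiver.Path.obj_eq_of_cons_eq_cons h)
        (Quiver.Path.hom_heq_of_cons_eq_cons h)).symm
    · simp
  · exact freeCoord_pathMap_of_ne _ _ (fun p' h => hq ⟨p', h⟩) _

end Algebra

end QuiverRep

/-! ### Branches of separated monic representations -/

lemma iSupIndep_of_sum_eq_zero {R : Type*} {N : Type*} [Ring R] [AddCommGroup N] [Module R N]
    {ι : Type*} [Fintype ι] {p : ι → Submodule R N}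
    (h : ∀ v : ι → N, (∀ i, v i ∈ p i) → ∑ i, v i = 0 → ∀ i, v i = 0) : iSupIndep p := by
  classical
  rw [iSupIndep_iff_finsetSum_eq_zero_imp_eq_zero]
  intro s v hv h₀ i hi
  have key := h (fun i => if i ∈ s then v i else 0) (fun i => ?_) ?_ i
  · simpa [hi] using key
  · split_ifs with hi
    · exact hv i hi
    · exact zero_mem _
  · simpa using h₀

/-- The range is an extension of `M / U` by `φ(U)`, because `U` contains the kernel of `φ`. -/
lemma IsExtensionClosedIn.mem_range {A : Type u} [Ring A] [IsNoetherianRing A]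
    {𝒳 : ObjectProperty (ModuleCat.{u} A)} (h𝒳 : IsExtensionClosedIn (ModuleCat.isFG A) 𝒳)
    {M N : Type u} [AddCommGroup M] [Module A M] [AddCommGroup N] [Module A N]
    [Module.Finite A M] (φ : M →ₗ[A] N) (U : Submodule A M) (hU : LinearMap.ker φ ≤ U)
    (h₁ : ModMem 𝒳 (U.map φ)) (h₂ : ModMem 𝒳 (M ⧸ U)) : ModMem 𝒳 (LinearMap.range φ) := by
  have hle : U.map φ ≤ LinearMap.range φ := LinearMap.map_le_range
  refine h𝒳.mem_of_submodule ((U.map φ).submoduleOf (LinearMap.range φ))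
    (h𝒳.mem_of_equiv (Submodule.submoduleOfEquivOfLe hle).symm h₁) ?_
  refine h𝒳.mem_of_ker_eq (f := U.mkQ)
    (g := ((U.map φ).submoduleOf (LinearMap.range φ)).mkQ ∘ₗ φ.rangeRestrict)
    U.mkQ_surjective ((Submodule.mkQ_surjective _).comp φ.surjective_rangeRestrict)
    (fun x => ?_) h₂
  rw [LinearMap.comp_apply, Submodule.mkQ_apply, Submodule.mkQ_apply,
    Submodule.Quotient.mk_eq_zero, Submodule.Quotient.mk_eq_zero]
  change x ∈ U ↔ φ x ∈ U.map φ
  constructor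
  · exact fun h => ⟨x, h, rfl⟩
  · rintro ⟨y, hy, hxy⟩
    have : x - y ∈ U := hU (by rw [LinearMap.mem_ker, map_sub, hxy, sub_self])
    simpa using add_mem this hy

namespace QuiverRep

variable {V : Type w} [Quiver.{w'} V] {I : MonomialRelations V} {A : Type u} [Ring A]
  {𝒳 : ObjectProperty (ModuleCat.{u} A)}

lemma smon_iff [∀ i : V, Fintype (InArrow i)] {X : QuiverRep V A} :
    smon I 𝒳 X ↔ (∀ i, Module.Finite A (X.br i)) ∧ X.SatisfiesRelations I ∧ X.IsSeparated I ∧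
      ∀ i, 𝒳 (X.cok i) := by
  constructor
  · intro h
    exact ⟨h.boundRep.1, h.boundRep.2, isSeparated_of_conditions h.m1 h.m2, h.m3⟩
  · rintro ⟨h₁, h₂, h₃, h₄⟩
    exact ⟨⟨h₁, h₂⟩, h₃.iSupIndep h₂, fun j i α => h₃.ker_eq h₂ α, h₄⟩

/-! ### Exactness properties of the cokernels at vertices. -/

section Cokernels

variable [∀ i : V, Fintype (InArrow i)]

variable {X Y Z : QuiverRep V A} {f : X ⟶ Y} {g : Y ⟶ Z}

/-- The map induced on cokernels. -/
def cokMap {X Y : QuiverRep V A} (f : X ⟶ Y) (i : V) : X.cok i →ₗ[A] Y.cok i :=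
  (X.imageSum i).mapQ (Y.imageSum i) (homAt f i) fun _ hx => homAt_mem_imageSum f hx

lemma cokMap_cokπ (f : X ⟶ Y) {i : V} (x : X.br i) :
    cokMap f i (X.cokπ i x) = Y.cokπ i (homAt f i x) := rfl

lemma cokMap_surjective (hg : ∀ i, Function.Surjective (homAt g i)) (i : V) :
    Function.Surjective (cokMap g i) := by
  intro z
  obtain ⟨z, rfl⟩ := Z.cokπ_surjective i z
  obtain ⟨y, rfl⟩ := hg i z
  exact ⟨_, cokMap_cokπ g y⟩

lemma cokMap_injective (hc : ∀ i x, homAt f i x ∈ Y.imageSum i → x ∈ X.imageSum i) (i : V) :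
    Function.Injective (cokMap f i) := by
  rw [injective_iff_map_eq_zero]
  intro x hx
  obtain ⟨x, rfl⟩ := X.cokπ_surjective i x
  rw [cokMap_cokπ, cokπ_eq_zero_iff] at hx
  exact cokπ_eq_zero_iff.2 (hc i x hx)

lemma cokMap_exact (hfg : ∀ i, Function.Exact (homAt f i) (homAt g i))
    (hg : ∀ i, Function.Surjective (homAt g i)) (i : V) :
    Function.Exact (cokMap f i) (cokMap g i) := by
  intro y
  obtain ⟨y, rfl⟩ := Y.cokπ_surjective i y
  constructor
  · intro h
    rw [cokMap_cokπ, cokπ_eq_zero_iff] at h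
    obtain ⟨y', hy', h'⟩ := exists_mem_imageSum g hg h
    obtain ⟨x, hx⟩ := (hfg i (y - y')).1 (by rw [map_sub, h', sub_self])
    refine ⟨X.cokπ i x, ?_⟩
    rw [cokMap_cokπ, hx, map_sub, cokπ_eq_zero_iff.2 hy', sub_zero]
  · rintro ⟨x, hx⟩
    obtain ⟨x, rfl⟩ := X.cokπ_surjective i x
    rw [← hx, cokMap_cokπ, cokMap_cokπ, (hfg i _).2 ⟨x, rfl⟩, map_zero]

end Cokernels

lemma isExtensionClosedIn_smon [∀ i : V, Fintype (InArrow i)]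
    (h𝒳 : IsExtensionClosedIn (ModuleCat.isFG A) 𝒳) :
    IsExtensionClosedIn (boundRep A I) (smon I 𝒳) where
  le X hX := hX.boundRep
  closedUnderIso := by
    refine ⟨fun {X Y} e hX => ?_⟩
    obtain ⟨hfg, hI, hs, hc⟩ := smon_iff.1 hX
    have h₁ : ∀ i x, homAt e.inv i (homAt e.hom i x) = x := fun i x => by
      rw [← homAt_comp, e.hom_inv_id]; rfl
    have h₂ : ∀ i y, homAt e.hom i (homAt e.inv i y) = y := fun i x => by
      rw [← homAt_comp, e.inv_hom_id]; rfl
    have hsurj : ∀ i, Function.Surjective (homAt e.hom i) := fun i y => ⟨_, h₂ i y⟩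
    refine smon_iff.2 ⟨fun i => ?_, hI.of_surjective (homAt_isAddMap e.hom) hsurj,
      hs.of_retract (homAt_isAddMap e.hom) (homAt_isAddMap e.inv) h₂, fun i => ?_⟩
    · have := hfg i
      exact Module.Finite.of_surjective _ (hsurj i)
    · refine h𝒳.mem_of_equiv (LinearEquiv.ofBijective (cokMap e.hom i)
        ⟨cokMap_injective (fun i x hx => ?_) i, cokMap_surjective hsurj i⟩) (hc i)
      rw [← h₁ i x]
      exact homAt_mem_imageSum e.inv hx
  containsZero := by
    obtain ⟨Z, hZ⟩ := HasZeroObject.zero (C := QuiverRep V A)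
    have hsub : ∀ i, Subsingleton (Z.br i) := fun i =>
      ModuleCat.subsingleton_of_isZero (hZ.obj _)
    refine ⟨Z, hZ, smon_iff.2 ⟨fun i => inferInstance, fun i j p _ => ?_, fun i x _ α => ?_,
      fun i => ?_⟩⟩
    · ext x
      exact Subsingleton.elim _ _
    · rw [Subsingleton.elim (x α) 0]
      exact zero_mem _
    · have : Subsingleton (Z.br i ⧸ Z.imageSum i) := (Z.cokπ_surjective i).subsingleton
      exact h𝒳.mem_of_subsingleton (M := Z.br i ⧸ Z.imageSum i)
  ext S hS hY hX hZ := by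
    obtain ⟨-, -, hXs, hXc⟩ := smon_iff.1 hX
    obtain ⟨-, -, hZs, hZc⟩ := smon_iff.1 hZ
    have h := shortExact_iff.1 hS
    refine smon_iff.2 ⟨hY.1, hY.2, hXs.extension (fun i => (h i).1) (fun i => (h i).2.1)
      (fun i => (h i).2.2) hY.2 hZs, fun i => ?_⟩
    have : Module.Finite A (S.X₂.br i) := hY.1 i
    have : Module.Finite A (S.X₂.cok i) :=
      Module.Finite.of_surjective _ (S.X₂.cokπ_surjective i)
    exact h𝒳.mem_of_exact
      (cokMap_injective (fun i x hx => hZs.mem_imageSum_of_homAt (fun i => (h i).2.1)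
        (fun i => (h i).1) (fun i => (h i).2.2) hY.2 hx) i)
      (cokMap_exact (fun i => (h i).2.1) (fun i => (h i).2.2) i)
      (cokMap_surjective (fun i => (h i).2.2) i) (hXc i) (hZc i)

variable [IsNoetherianRing A] [∀ i : V, Fintype (InArrow i)]
  [∀ i : V, Finite (Σ j : V, Quiver.Path j i)]

/-- The image of the sum over arrows under `X_p` is the direct sum of the images along `α` followed
by `p`. Each nonzero one is an extension of the cokernel at the start of `α` by a module of the same
kind at smaller rank. The induction needs all `p`, though mainly the trivial path is of interest. -/
lemma mem_map_imageSum (k : Type u) [Field k] [Algebra k A] {r : V → ℕ} (hr : IsRank r)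
    (h𝒳 : IsExtensionClosedIn (ModuleCat.isFG A) 𝒳) {X : QuiverRep V A} (hX : smon I 𝒳 X)
    (i : V) : ∀ {j : V} (p : Quiver.Path i j), ¬ I.Mem p →
      ModMem 𝒳 ((X.imageSum i).map (X.pathMap p)) := by
  obtain ⟨hfg, hI, hs, hc⟩ := smon_iff.1 hX
  induction i using hr.induction with
  | h i ih =>
    intro j p hp
    have := hfg j
    have h₁ : (X.imageSum i).map (X.pathMap p) =
        ⨆ α : InArrow i, LinearMap.range (X.pathMap p ∘ₗ X.pathMap α.2.toPath) := by
      rw [imageSum, Submodule.map_iSup]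
      exact iSup_congr fun α => (LinearMap.range_comp _ _).symm
    rw [h₁]
    refine h𝒳.mem_iSup_of_iSupIndep (iSupIndep_of_sum_eq_zero fun v hv h₀ α => ?_) fun α => ?_
    · choose y hy using hv
      rw [← hy]
      refine hs.pathMap_eq_zero_of_sum k hr hI p y ?_ α
      rw [arrowSum_apply, map_sum, ← h₀]
      exact Finset.sum_congr rfl fun α _ => hy α
    · rw [← pathMap_comp]
      by_cases hq : I.Mem (α.2.toPath.comp p)
      · have : LinearMap.range (X.pathMap (α.2.toPath.comp p)) = ⊥ := by
          rw [LinearMap.range_eq_bot]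
          ext x
          exact hI.pathMap_eq_zero hq x
        rw [this]
        exact h𝒳.mem_bot
      · have := hfg α.1
        exact h𝒳.mem_range _ (X.imageSum α.1)
          (fun x hx => hs.ker_pathMap_le k hr hI hq hx) (ih _ α.2 _ hq) (hc α.1)

lemma mem_imageSum (k : Type u) [Field k] [Algebra k A] {r : V → ℕ} (hr : IsRank r)
    (h𝒳 : IsExtensionClosedIn (ModuleCat.isFG A) 𝒳) {X : QuiverRep V A} (hX : smon I 𝒳 X)
    (i : V) : ModMem 𝒳 (X.imageSum i) := by
  have := mem_map_imageSum k hr h𝒳 hX i Quiver.Path.nil (NonzeroPath.nil I i).2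
  rwa [pathMap_nil, Submodule.map_id] at this

lemma mem_br (k : Type u) [Field k] [Algebra k A] {r : V → ℕ} (hr : IsRank r)
    (h𝒳 : IsExtensionClosedIn (ModuleCat.isFG A) 𝒳) {X : QuiverRep V A} (hX : smon I 𝒳 X)
    (i : V) : 𝒳 (X.br i) :=
  have := (smon_iff.1 hX).1 i
  h𝒳.mem_of_submodule (X.imageSum i) (mem_imageSum k hr h𝒳 hX i) ((smon_iff.1 hX).2.2.2 i)

end QuiverRep

/-! ### Frobenius subcategories of modules give Frobenius subcategories of representations -/

section Retracts

variable {C : Type u} [Category.{v} C] [Abelian C] {𝓕 : ObjectProperty C}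

lemma IsProjectiveObject.of_retract {P L : C} (hP : IsProjectiveObject 𝓕 P) (hL : 𝓕 L)
    (s : L ⟶ P) (p : P ⟶ L) (h : s ≫ p = 𝟙 L) : IsProjectiveObject 𝓕 L := by
  refine ⟨hL, fun S hS a => ?_⟩
  obtain ⟨b, hb⟩ := hP.2 S hS (p ≫ a)
  exact ⟨s ≫ b, by rw [Category.assoc, hb, ← Category.assoc, h, Category.id_comp]⟩

lemma IsInjectiveObject.of_retract {J L : C} (hJ : IsInjectiveObject 𝓕 J) (hL : 𝓕 L)
    (s : L ⟶ J) (p : J ⟶ L) (h : s ≫ p = 𝟙 L) : IsInjectiveObject 𝓕 L := by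
  refine ⟨hL, fun S hS a => ?_⟩
  obtain ⟨b, hb⟩ := hJ.2 S hS (a ≫ s)
  exact ⟨b ≫ p, by rw [← Category.assoc, hb, Category.assoc, h, Category.comp_id]⟩

end Retracts

lemma ModuleCat.exact_of_shortExact {A : Type u} [Ring A] {S : ShortComplex (ModuleCat.{u} A)}
    (h : S.ShortExact) : Function.Injective S.f.hom ∧ Function.Exact S.f.hom S.g.hom ∧
      Function.Surjective S.g.hom :=
  ⟨h.moduleCat_injective_f,
    (ShortComplex.ShortExact.moduleCat_exact_iff_function_exact _).1 h.exact,
    h.moduleCat_surjective_g⟩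

namespace QuiverRep

variable {V : Type w} [Quiver.{w'} V] {I : MonomialRelations V} {A : Type u} [Ring A]
  {𝒳 : ObjectProperty (ModuleCat.{u} A)} [∀ i : V, Fintype (InArrow i)]

/-- Construction of a homomorphism vertex by vertex. -/
lemma IsSeparated.exists_hom [Finite V] {r : V → ℕ} (hr : IsRank r) {X N : QuiverRep V A}
    (hX : X.IsSeparated I) (hN : N.SatisfiesRelations I)
    (Q : ∀ i, (X.br i →ₗ[A] N.br i) → Prop)
    (step : ∀ (i : V) (v : ∀ j, X.br j →ₗ[A] N.br j), (∀ j, (j ⟶ i) → Q j (v j)) →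
      (∀ x, X.arrowSum i x = 0 → N.arrowSum i (fun α => v α.1 (x α)) = 0) →
      ∃ h : X.br i →ₗ[A] N.br i,
        (∀ x, h (X.arrowSum i x) = N.arrowSum i (fun α => v α.1 (x α))) ∧ Q i h) :
    ∃ f : X ⟶ N, ∀ i, Q i (homAt f i) := by
  classical
  obtain ⟨F, hF⟩ := hr.exists_family (β := fun i => X.br i →ₗ[A] N.br i)
    (fun i h v => (∀ x : ∀ α : InArrow i, X.br α.1, h (X.arrowSum i x) =
      N.arrowSum i (fun α => v α.1 α.2 (x α))) ∧ Q i h) (by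
    intro i F hF
    refine step i F (fun j α => (hF j (hr α)).2) fun x hx => ?_
    -- The components below the rank of `i` commute with sums over arrows. Families supported at one
    -- arrow show that they commute with single arrows, hence with paths.
    have hpath : ∀ {h j : V} (p : Quiver.Path h j), r j < r i → ∀ x,
        F j (X.pathMap p x) = N.pathMap p (F h x) := by
      intro h j p
      induction p with
      | nil => intro _ x; rw [pathMap_nil, pathMap_nil]; rfl
      | @cons a b p α ih =>
        intro hj x
        have h₁ := (hF b hj).1 (Pi.single ⟨a, α⟩ (X.pathMap p x))
        rw [arrowSum_single] at h₁
        rw [pathMap_cons_apply, h₁, pathMap_cons_apply, ← ih ((hr α).trans hj),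
          ← arrowSum_single N (⟨a, α⟩ : InArrow b)]
        congr 1
        funext β
        by_cases hβ : β = ⟨a, α⟩
        · subst hβ
          rw [Pi.single_eq_same, Pi.single_eq_same]
        · rw [Pi.single_eq_of_ne hβ, Pi.single_eq_of_ne hβ, map_zero]
    rw [arrowSum_apply]
    -- Separatedness writes each `x α` through paths in `K_α`; their continuations by `α` lie in the
    -- ideal and act as zero on `N`.
    refine Finset.sum_eq_zero fun α _ => ?_
    refine relKernel_induction (P := fun y => N.pathMap α.2.toPath (F α.1 y) = 0) ?_ ?_ ?_
      (hX i x hx α)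
    · rw [map_zero, map_zero]
    · intro y z hy hz
      rw [map_add, map_add, hy, hz, add_zero]
    · intro h p hp y
      rw [hpath p (hr α.2), ← pathMap_cons_apply]
      exact hN.pathMap_eq_zero hp.2.2 _)
  refine ⟨mkHom F fun i j α x => ?_, fun i => (hF i).2⟩
  have h₁ := (hF j).1 (Pi.single ⟨i, α⟩ x)
  rw [arrowSum_single] at h₁
  rw [h₁, ← arrowSum_single N (⟨i, α⟩ : InArrow j)]
  congr 1
  funext β
  by_cases hβ : β = ⟨i, α⟩
  · subst hβ
    rw [Pi.single_eq_same, Pi.single_eq_same]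
  · rw [Pi.single_eq_of_ne hβ, Pi.single_eq_of_ne hβ, map_zero]

/-- The composition of a family of maps with the sum over the arrows. -/
def arrowSumComp {X N : QuiverRep V A} (v : ∀ j, X.br j →ₗ[A] N.br j) (i : V) :
    (∀ α : InArrow i, X.br α.1) →ₗ[A] N.br i :=
  N.arrowSum i ∘ₗ LinearMap.pi fun α => v α.1 ∘ₗ LinearMap.proj α

lemma arrowSumComp_apply {X N : QuiverRep V A} (v : ∀ j, X.br j →ₗ[A] N.br j) (i : V)
    (x : ∀ α : InArrow i, X.br α.1) :
    arrowSumComp v i x = N.arrowSum i fun α => v α.1 (x α) := rfl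

section Free

variable [∀ i : V, Finite (Σ j : V, Quiver.Path j i)]

lemma freeRep_mem_smon (h𝒳 : IsExtensionClosedIn (ModuleCat.isFG A) 𝒳)
    {M : V → ModuleCat.{u} A} (hM : ∀ i, 𝒳 (M i)) : smon I 𝒳 (freeRep I M) :=
  smon_iff.2 ⟨finite_freeBr fun i => h𝒳.finite (hM i), freeRep_satisfiesRelations,
    freeRep_isSeparated, fun i => h𝒳.mem_of_ker_eq (freeTop_surjective i)
      ((freeRep I M).cokπ_surjective i)
      (fun _ => freeTop_eq_zero_iff.trans cokπ_eq_zero_iff.symm) (hM i)⟩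

end Free

variable [IsNoetherianRing A] [∀ i : V, Finite (Σ j : V, Quiver.Path j i)]

/-- A lift is determined on generators, and at each vertex the branches of a conflation form a
conflation in `𝒳` by `mem_br`. -/
lemma freeRep_isProjectiveObject (k : Type u) [Field k] [Algebra k A] {r : V → ℕ}
    (hr : IsRank r) (h𝒳 : IsExtensionClosedIn (ModuleCat.isFG A) 𝒳) {P : V → ModuleCat.{u} A}
    (hP : ∀ i, IsProjectiveObject 𝒳 (P i)) : IsProjectiveObject (smon I 𝒳) (freeRep I P) := by
  refine ⟨freeRep_mem_smon h𝒳 fun i => (hP i).1, fun S hS a => ?_⟩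
  have h := shortExact_iff.1 hS.shortExact
  have hlift : ∀ i, ∃ b : P i →ₗ[A] S.X₂.br i,
      ∀ x, homAt S.g i (b x) = (homAt a i ∘ₗ freeGen i) x := fun i =>
    IsProjectiveObject.exists_lift (hP i) (h i).1 (h i).2.1 (h i).2.2
      (mem_br k hr h𝒳 hS.left i) (mem_br k hr h𝒳 hS.middle i) (mem_br k hr h𝒳 hS.right i) _
  choose b hb using hlift
  have hYI := (smon_iff.1 hS.middle).2.1
  refine ⟨freeHom hYI b, freeRep_homs_ext fun i m => ?_⟩
  rw [homAt_comp, freeHom_gen, hb]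
  rfl

/-- The extension is built by increasing rank. At a vertex it is prescribed on the sum over incoming
arrows and on the image of `S.f`; relative injectivity of the branch of `N` extends it from there.
-/
lemma exists_extension_of_isRelativelyInjective (k : Type u) [Field k] [Algebra k A] [Finite V]
    {r : V → ℕ} (hr : IsRank r) (h𝒳 : IsExtensionClosedIn (ModuleCat.isFG A) 𝒳)
    {N : QuiverRep V A} (hN : N.SatisfiesRelations I)
    (hNi : ∀ i, IsRelativelyInjective 𝒳 (N.br i)) {S : ShortComplex (QuiverRep V A)}
    (hS : IsConflation (smon I 𝒳) S) (u : S.X₁ ⟶ N) : ∃ v : S.X₂ ⟶ N, S.f ≫ v = u := by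
  have h := shortExact_iff.1 hS.shortExact
  obtain ⟨-, hYI, hYs, -⟩ := smon_iff.1 hS.middle
  obtain ⟨-, hZI, hZs, hZc⟩ := smon_iff.1 hS.right
  have hc : ∀ i x, homAt S.f i x ∈ S.X₂.imageSum i → x ∈ S.X₁.imageSum i := fun i x hx =>
    hZs.mem_imageSum_of_homAt (fun i => (h i).2.1) (fun i => (h i).1) (fun i => (h i).2.2) hYI hx
  obtain ⟨v, hv⟩ := hYs.exists_hom hr hN
    (fun i b => ∀ x, b (homAt S.f i x) = homAt u i x) (by
    intro i v hv hv₀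
    -- The range of `φ` is the preimage of the image sum of `S.X₃`. It is thus an extension of that
    -- image sum by the branch of `S.X₁`, with quotient the cokernel of `S.X₃`, and all of these lie
    -- in `𝒳`.
    let φ : (∀ α : InArrow i, S.X₂.br α.1) × S.X₁.br i →ₗ[A] S.X₂.br i :=
      (S.X₂.arrowSum i).coprod (homAt S.f i)
    have hφ : ∀ y, y ∈ LinearMap.range φ ↔ homAt S.g i y ∈ S.X₃.imageSum i := by
      intro y
      constructor
      · rintro ⟨⟨y, x⟩, rfl⟩
        change homAt S.g i (S.X₂.arrowSum i y + homAt S.f i x) ∈ _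
        rw [map_add, ((h i).2.1 _).2 ⟨x, rfl⟩, add_zero]
        exact homAt_mem_imageSum _ (arrowSum_mem _ _)
      · intro hy
        obtain ⟨y', hy', hyy'⟩ := exists_mem_imageSum S.g (fun i => (h i).2.2) hy
        obtain ⟨y', rfl⟩ := mem_imageSum_iff.1 hy'
        obtain ⟨x, hx⟩ := ((h i).2.1 (y - S.X₂.arrowSum i y')).1
          (by rw [map_sub, hyy', sub_self])
        refine ⟨(y', x), ?_⟩
        change S.X₂.arrowSum i y' + homAt S.f i x = y
        rw [hx]; abel
    obtain ⟨b, hb⟩ : ∃ b : S.X₂.br i →ₗ[A] N.br i,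
        ∀ d, b (φ d) = ((arrowSumComp v i).coprod (homAt u i)) d := by
      refine (hNi i).exists_factor (M := S.X₂.br i) φ _ ?_ ?_
        (mem_br k hr h𝒳 hS.middle i) ?_
      · rintro ⟨y, x⟩ hyx
        change S.X₂.arrowSum i y + homAt S.f i x = 0 at hyx
        change arrowSumComp v i y + homAt u i x = 0
        -- The two prescriptions agree on the overlap: by left exactness of cokernels, `-x` is
        -- already a sum over arrows in `S.X₁`, where `v` restricts to `u`.
        have hx : homAt S.f i (-x) = S.X₂.arrowSum i y := by
          rw [map_neg, neg_eq_iff_add_eq_zero, add_comm, hyx]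
        obtain ⟨x', hx'⟩ := mem_imageSum_iff.1
          (hc i (-x) (by rw [hx]; exact arrowSum_mem _ _))
        have h₁ : S.X₂.arrowSum i (y - fun α => homAt S.f α.1 (x' α)) = 0 := by
          rw [map_sub, ← homAt_arrowSum, hx', hx, sub_self]
        have h₂ := hv₀ _ h₁
        rw [← arrowSumComp_apply, map_sub, sub_eq_zero] at h₂
        rw [h₂, arrowSumComp_apply]
        have h₃ : (fun α : InArrow i => v α.1 (homAt S.f α.1 (x' α))) =
            fun α : InArrow i => homAt u α.1 (x' α) := funext fun α => hv α.1 α.2 _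
        rw [h₃, ← homAt_arrowSum, hx', map_neg, neg_add_cancel]
      · have := (smon_iff.1 hS.middle).1 i
        refine h𝒳.mem_of_exact
          (f := (homAt S.f i).codRestrict (LinearMap.range φ) fun x => ⟨(0, x), by simp [φ]⟩)
          (g := ((homAt S.g i) ∘ₗ (LinearMap.range φ).subtype).codRestrict (S.X₃.imageSum i)
            fun y => (hφ y).1 y.2) ?_ ?_ ?_ (mem_br k hr h𝒳 hS.left i)
          (mem_imageSum k hr h𝒳 hS.right i)
        · intro x y hxy
          exact (h i).1 (congrArg Subtype.val hxy)
        · rintro ⟨y, hy⟩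
          constructor
          · intro hy₀
            obtain ⟨x, hx⟩ := ((h i).2.1 y).1 (congrArg Subtype.val hy₀)
            exact ⟨x, Subtype.ext hx⟩
          · rintro ⟨x, hx⟩
            have hx : homAt S.f i x = y := congrArg Subtype.val hx
            exact Subtype.ext (((h i).2.1 y).2 ⟨x, hx⟩)
        · rintro ⟨z, hz⟩
          obtain ⟨y, hy⟩ := (h i).2.2 z
          exact ⟨⟨y, (hφ y).2 (hy ▸ hz)⟩, Subtype.ext hy⟩
      · refine h𝒳.mem_of_ker_eq (f := S.X₃.cokπ i ∘ₗ homAt S.g i)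
          (g := (LinearMap.range φ).mkQ) ((S.X₃.cokπ_surjective i).comp (h i).2.2)
          (Submodule.mkQ_surjective _) (fun y => ?_) (hZc i)
        rw [Submodule.mkQ_apply, Submodule.Quotient.mk_eq_zero, hφ]
        exact cokπ_eq_zero_iff
    refine ⟨b, fun y => ?_, fun x => ?_⟩
    · simpa [φ, arrowSumComp_apply] using hb (y, 0)
    · simpa [φ] using hb (0, x))
  exact ⟨v, hom_ext fun i x => hv i x⟩

lemma freeRep_isInjectiveObject (k : Type u) [Field k] [Algebra k A] [Finite V] {r : V → ℕ}
    (hr : IsRank r) (h𝒳 : IsExtensionClosedIn (ModuleCat.isFG A) 𝒳) {J : V → ModuleCat.{u} A}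
    (hJ : ∀ i, IsInjectiveObject 𝒳 (J i)) : IsInjectiveObject (smon I 𝒳) (freeRep I J) :=
  ⟨freeRep_mem_smon h𝒳 fun i => (hJ i).1, fun _ hS u =>
    exists_extension_of_isRelativelyInjective k hr h𝒳 freeRep_satisfiesRelations
      (isRelativelyInjective_freeBr fun i => (hJ i).isRelativelyInjective) hS u⟩

/-- Each object has a conflation ending in it with a projective generated middle term. -/
lemma exists_conflation_freeRep_left (k : Type u) [Field k] [Algebra k A] {r : V → ℕ}
    (hr : IsRank r) (h𝒳 : IsExtensionClosedIn (ModuleCat.isFG A) 𝒳)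
    (hp : HasEnoughProjectiveObjects 𝒳) {X : QuiverRep V A} (hX : smon I 𝒳 X) :
    ∃ (P : V → ModuleCat.{u} A) (K : QuiverRep V A) (f : K ⟶ freeRep I P) (g : freeRep I P ⟶ X)
      (zero : f ≫ g = 0), (∀ i, IsProjectiveObject 𝒳 (P i)) ∧
        IsConflation (smon I 𝒳) (ShortComplex.mk f g zero) := by
  obtain ⟨hXf, hXI, hXs, hXc⟩ := smon_iff.1 hX
  choose K₀ P a b zero hab hP using fun i => hp _ (hXc i)
  -- The projection of a branch to its cokernel is a deflation in `𝒳`, since the image sum lies in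
  -- `𝒳`; so the cover of the cokernel lifts to the branch.
  have hlift : ∀ i, ∃ c : P i →ₗ[A] X.br i, ∀ x, X.cokπ i (c x) = (b i).hom x := fun i =>
    IsProjectiveObject.exists_lift (hP i) (X.imageSum i).subtype_injective
      (LinearMap.exact_subtype_mkQ (X.imageSum i)) (X.cokπ_surjective i)
      (mem_imageSum k hr h𝒳 hX i) (mem_br k hr h𝒳 hX i) (hXc i) _
  choose c hc using hlift
  obtain ⟨g, hg⟩ : ∃ g : freeRep I P ⟶ X, ∀ i (x : P i), homAt g i (freeGen i x) = c i x :=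
    ⟨freeHom hXI c, fun i x => freeHom_gen hXI c x⟩
  have hex := fun i => ModuleCat.exact_of_shortExact (hab i).shortExact
  have hcok : ∀ i t, X.cokπ i (homAt g i t) = (b i).hom (freeTop i t) := by
    intro i t
    have h₁ := homAt_mem_imageSum g (sub_freeGen_mem t)
    rw [← cokπ_eq_zero_iff, map_sub, map_sub, hg, hc, sub_eq_zero] at h₁
    exact h₁
  have hsurj : ∀ i, Function.Surjective (homAt g i) := by
    refine surjective_of_cok_surjective hr g fun i x => ?_
    obtain ⟨m, hm⟩ := (hex i).2.2 (X.cokπ i x)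
    refine ⟨freeGen i m, ?_⟩
    rw [← cokπ_eq_zero_iff, map_sub, hcok, freeTop_gen, sub_eq_zero]
    exact hm.symm
  have := epi_of_surjective g hsurj
  have hS : (ShortComplex.mk (kernel.ι g) g (kernel.condition g)).ShortExact :=
    ⟨ShortComplex.exact_kernel g⟩
  have h := shortExact_iff.1 hS
  have hT : smon I 𝒳 (freeRep I P) := freeRep_mem_smon h𝒳 fun i => (hP i).1
  obtain ⟨hTf, hTI, hTs, -⟩ := smon_iff.1 hT
  refine ⟨P, kernel g, kernel.ι g, g, kernel.condition g, hP, hS, smon_iff.2 ⟨fun i => ?_,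
    hTI.of_injective (homAt_isAddMap _) fun i => (h i).1,
    IsSeparated.kernel k hr (fun i => (h i).1) (fun i => (h i).2.1) hsurj hTI hTs hXs,
    fun i => ?_⟩, hT, hX⟩
  · have := hTf i
    exact Module.Finite.of_injective _ (h i).1
  -- The cokernel of the kernel is `K₀ i`, embedded in `P i` by `a i`: `F` has the range of `a i` as
  -- image and the image sum as kernel.
  · let F : (kernel g).br i →ₗ[A] P i := freeTop i ∘ₗ homAt (kernel.ι g) i
    have hF : ∀ x, F x ∈ LinearMap.range (a i).hom := by
      intro x
      refine ((hex i).2.1 _).1 ?_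
      change (b i).hom (freeTop i (homAt (kernel.ι g) i x)) = 0
      rw [← hcok]
      have : homAt g i (homAt (kernel.ι g) i x) = 0 := ((h i).2.1 _).2 ⟨x, rfl⟩
      rw [this, map_zero]
    refine h𝒳.mem_of_ker_eq (f := F.codRestrict _ hF) (g := (kernel g).cokπ i) ?_
      ((kernel g).cokπ_surjective i) (fun x => ?_)
      (h𝒳.mem_of_equiv (LinearEquiv.ofInjective _ (hex i).1) (hab i).left)
    · rintro ⟨_, m, rfl⟩
      have h₁ : homAt g i (freeGen i ((a i).hom m)) ∈ X.imageSum i := by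
        rw [← cokπ_eq_zero_iff, hcok, freeTop_gen]
        exact ((hex i).2.1 _).2 ⟨m, rfl⟩
      obtain ⟨s, hs, hgs⟩ := exists_mem_imageSum g hsurj h₁
      obtain ⟨x, hx⟩ := ((h i).2.1 (freeGen i ((a i).hom m) - s)).1 (by
        change homAt g i _ = 0
        rw [map_sub, hgs, sub_self])
      refine ⟨x, Subtype.ext ?_⟩
      change freeTop i (homAt (kernel.ι g) i x) = (a i).hom m
      change homAt (kernel.ι g) i x = _ at hx
      rw [hx, map_sub, freeTop_gen, freeTop_eq_zero_iff.2 hs, sub_zero]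
    · refine Iff.trans (Subtype.ext_iff.trans freeTop_eq_zero_iff) (Iff.trans ?_
        cokπ_eq_zero_iff.symm)
      exact ⟨fun hx => hXs.mem_imageSum_of_homAt (fun i => (h i).2.1) (fun i => (h i).1)
        hsurj hTI hx, fun hx => homAt_mem_imageSum _ hx⟩

/-- Each object has a conflation starting in it with an injective generated middle term. -/
lemma exists_conflation_freeRep_right (k : Type u) [Field k] [Algebra k A] [Finite V] {r : V → ℕ}
    (hr : IsRank r) (h𝒳 : IsExtensionClosedIn (ModuleCat.isFG A) 𝒳)
    (hi : HasEnoughInjectiveObjects 𝒳) {X : QuiverRep V A} (hX : smon I 𝒳 X) :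
    ∃ (J : V → ModuleCat.{u} A) (Z : QuiverRep V A) (f : X ⟶ freeRep I J) (g : freeRep I J ⟶ Z)
      (zero : f ≫ g = 0), (∀ i, IsInjectiveObject 𝒳 (J i)) ∧
        IsConflation (smon I 𝒳) (ShortComplex.mk f g zero) := by
  obtain ⟨hXf, hXI, hXs, hXc⟩ := smon_iff.1 hX
  choose J Z₀ a b zero hab hJ using fun i => hi _ (hXc i)
  have hex := fun i => ModuleCat.exact_of_shortExact (hab i).shortExact
  have hT : smon I 𝒳 (freeRep I J) := freeRep_mem_smon h𝒳 fun i => (hJ i).1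
  obtain ⟨hTf, hTI, hTs, -⟩ := smon_iff.1 hT
  obtain ⟨f, hf⟩ := hXs.exists_hom hr hTI
    (fun i h => ∀ x, freeTop i (h x) = (a i).hom (X.cokπ i x)) (by
    intro i v _ hv₀
    have hr' := range_arrowSum X i
    obtain ⟨h, hh⟩ := (isRelativelyInjective_freeBr (I := I)
      (fun i => (hJ i).isRelativelyInjective) i).exists_factor (M := X.br i)
      (X.arrowSum i) (arrowSumComp (N := freeRep I J) v i) hv₀
      (by rw [hr']; exact mem_imageSum k hr h𝒳 hX i) (mem_br k hr h𝒳 hX i)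
      (by rw [hr']; exact hXc i)
    let h' : X.br i →ₗ[A] (freeRep I J).br i := h
    -- Any extension `h'` is corrected on the generators so that its top component becomes the
    -- chosen embedding of the cokernel. The correction vanishes on sums over arrows, so
    -- compatibility with the arrows survives.
    refine ⟨h' + freeGen i ∘ₗ ((a i).hom ∘ₗ X.cokπ i - freeTop i ∘ₗ h'), fun x => ?_,
      fun x => ?_⟩
    · have h₁ : h' (X.arrowSum i x) = (freeRep I J).arrowSum i (fun α => v α.1 (x α)) := hh x
      change h' (X.arrowSum i x) + freeGen i ((a i).hom (X.cokπ i (X.arrowSum i x)) -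
        freeTop i (h' (X.arrowSum i x))) = _
      rw [h₁, cokπ_eq_zero_iff.2 (arrowSum_mem X x), freeTop_eq_zero_iff.2 (arrowSum_mem _ _)]
      erw [map_zero]
      rw [sub_zero, map_zero, add_zero]
    · change freeTop i (h' x + freeGen i ((a i).hom (X.cokπ i x) - freeTop i (h' x))) = _
      rw [map_add, freeTop_gen]
      abel)
  have hc : ∀ i x, homAt f i x ∈ (freeRep I J).imageSum i → x ∈ X.imageSum i := by
    intro i x hx
    rw [← freeTop_eq_zero_iff, hf] at hx
    exact cokπ_eq_zero_iff.1 ((injective_iff_map_eq_zero (a i).hom).1 (hex i).1 _ hx)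
  have := mono_of_injective f (IsSeparated.injective_of_cok_injective k hr hXI hTI hTs hc)
  have hS : (ShortComplex.mk f (cokernel.π f) (cokernel.condition f)).ShortExact :=
    ⟨ShortComplex.exact_cokernel f⟩
  have h := shortExact_iff.1 hS
  have hsurj : ∀ i, Function.Surjective (homAt (cokernel.π f) i) := fun i => (h i).2.2
  refine ⟨J, cokernel f, f, cokernel.π f, cokernel.condition f, hJ, hS, hX, hT, smon_iff.2
    ⟨fun i => ?_, hTI.of_surjective (homAt_isAddMap (cokernel.π f)) hsurj,
    hTs.quotient (fun i => (h i).2.1) hsurj hc, fun i => ?_⟩⟩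
  · have := hTf i
    exact Module.Finite.of_surjective _ (hsurj i)
  -- The cokernel of the quotient representation is `Z₀ i`: both are quotients of the branch of
  -- `freeRep I J` with the same kernel.
  · refine h𝒳.mem_of_ker_eq (f := (b i).hom ∘ₗ freeTop (I := I) (M := J) i)
      (g := (cokernel f).cokπ i ∘ₗ homAt (cokernel.π f) i) ((hex i).2.2.comp (freeTop_surjective i))
      (((cokernel f).cokπ_surjective i).comp (hsurj i)) (fun t => ?_) (hab i).right
    refine Iff.trans ?_ cokπ_eq_zero_iff.symm
    constructor
    · intro ht
      obtain ⟨y, hy⟩ := ((hex i).2.1 _).1 ht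
      obtain ⟨x, rfl⟩ := X.cokπ_surjective i y
      have h₁ : t - homAt f i x ∈ (freeRep I J).imageSum i := by
        rw [← freeTop_eq_zero_iff, map_sub, hf, sub_eq_zero]
        exact hy.symm
      have h₂ := homAt_mem_imageSum (cokernel.π f) h₁
      rwa [map_sub, ((h i).2.1 _).2 ⟨x, rfl⟩, sub_zero] at h₂
    · intro ht
      obtain ⟨s, hs, hst⟩ := exists_mem_imageSum _ hsurj ht
      obtain ⟨x, hx⟩ := ((h i).2.1 (t - s)).1 (by
        change homAt (cokernel.π f) i _ = 0
        rw [map_sub, hst, sub_self])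
      change homAt f i x = _ at hx
      have h₁ := hf i x
      rw [hx, map_sub, freeTop_eq_zero_iff.2 hs, sub_zero] at h₁
      change (b i).hom (freeTop i t) = 0
      rw [h₁]
      exact ((hex i).2.1 _).2 ⟨_, rfl⟩

lemma isFrobeniusSubcategory_smon (k : Type u) [Field k] [Algebra k A] [Finite V] {r : V → ℕ}
    (hr : IsRank r) (h𝒳 : IsFrobeniusSubcategory (ModuleCat.isFG A) 𝒳) :
    IsFrobeniusSubcategory (boundRep A I) (smon I 𝒳) where
  extensionClosed := isExtensionClosedIn_smon h𝒳.extensionClosed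
  enoughProjectives X hX := by
    obtain ⟨P, K, f, g, zero, hP, h⟩ :=
      exists_conflation_freeRep_left k hr h𝒳.extensionClosed h𝒳.enoughProjectives hX
    exact ⟨K, _, f, g, zero, h, freeRep_isProjectiveObject k hr h𝒳.extensionClosed hP⟩
  enoughInjectives X hX := by
    obtain ⟨J, Z, f, g, zero, hJ, h⟩ :=
      exists_conflation_freeRep_right k hr h𝒳.extensionClosed h𝒳.enoughInjectives hX
    exact ⟨_, Z, f, g, zero, h, freeRep_isInjectiveObject k hr h𝒳.extensionClosed hJ⟩
  projective_iff_injective L := by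
    constructor
    -- The conflation ending in `L` splits, so `L` is a summand of a representation generated by
    -- projectives of `𝒳`. These are injective in `𝒳` too.
    · intro hL
      obtain ⟨P, K, f, g, zero, hP, h⟩ :=
        exists_conflation_freeRep_left k hr h𝒳.extensionClosed h𝒳.enoughProjectives hL.1
      obtain ⟨s, hs⟩ := hL.2 _ h (𝟙 L)
      exact (freeRep_isInjectiveObject k hr h𝒳.extensionClosed fun i =>
        (h𝒳.projective_iff_injective _).1 (hP i)).of_retract hL.1 s g hs
    · intro hL
      obtain ⟨J, Z, f, g, zero, hJ, h⟩ :=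
        exists_conflation_freeRep_right k hr h𝒳.extensionClosed h𝒳.enoughInjectives hL.1
      obtain ⟨p, hp⟩ := hL.2 _ h (𝟙 L)
      exact (freeRep_isProjectiveObject k hr h𝒳.extensionClosed fun i =>
        (h𝒳.projective_iff_injective _).2 (hJ i)).of_retract hL.1 f p hp

end QuiverRep

/-! ### Representations concentrated at a sink -/

namespace QuiverRep

variable {V : Type w} [Quiver.{w'} V] {I : MonomialRelations V} {A : Type u} [Ring A]
  {𝒳 : ObjectProperty (ModuleCat.{u} A)}

/-- The representation with branch `M` at `i` and zero elsewhere. -/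
def sky (i : V) (M : ModuleCat.{u} A) : QuiverRep V A :=
  -- Functions on the proposition `j = i` give `M` at `i` and a one-point module elsewhere, without
  -- a case distinction in the type.
  mkRep (fun j => ModuleCat.of A (PLift (j = i) → M)) fun _ _ _ => 0

/-- The value at the vertex `i`. -/
def skyEval (i : V) (M : ModuleCat.{u} A) : (sky i M).br i →ₗ[A] M :=
  LinearMap.proj (φ := fun _ : PLift (i = i) => M) ⟨rfl⟩

/-- The element at `i` with given value. -/
def skyOf (i : V) (M : ModuleCat.{u} A) : M →ₗ[A] (sky i M).br i :=
  LinearMap.pi (φ := fun _ : PLift (i = i) => M) fun _ => LinearMap.id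

variable {i : V} {M N M₁ M₂ M₃ : ModuleCat.{u} A}

lemma skyEval_of (m : M) : skyEval i M (skyOf i M m) = m := rfl

lemma skyOf_eval (x : (sky i M).br i) : skyOf i M (skyEval i M x) = x := rfl

lemma skyEval_bijective : Function.Bijective (skyEval i M) :=
  ⟨fun x y h => by rw [← skyOf_eval x, h, skyOf_eval], fun m => ⟨_, skyEval_of m⟩⟩

lemma sky_subsingleton {j : V} (h : j ≠ i) : Subsingleton ((sky i M).br j) :=
  ⟨fun x y => funext (α := PLift (j = i)) (β := fun _ => M) (f := x) (g := y)
    fun h' => absurd h'.down h⟩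

lemma sky_toPath {j l : V} (α : j ⟶ l) (x : (sky i M).br j) :
    (sky i M).pathMap α.toPath x = 0 :=
  mkRep_pathMap_toPath _ _ α x

lemma sky_satisfiesRelations : (sky i M).SatisfiesRelations I := by
  intro j l p hp
  have := I.two_le_length p hp
  ext x
  cases p with
  | nil => simp at this
  | cons p α =>
    rw [pathMap_cons_apply, sky_toPath]
    rfl

lemma sky_imageSum (j : V) : (sky i M).imageSum j = ⊥ := by
  rw [eq_bot_iff]
  refine iSup_le fun α => ?_
  rintro _ ⟨x, rfl⟩
  exact sky_toPath α.2 x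

/-- The map on concentrated representations induced by a linear map. -/
def skyMap (i : V) (f : M →ₗ[A] N) : sky i M ⟶ sky i N :=
  mkHom (X := sky i M) (Y := sky i N)
    (fun j => LinearMap.compLeft f (PLift (j = i))) fun j l α x => by
      rw [sky_toPath, sky_toPath]
      exact (f.compLeft (PLift (l = i))).map_zero

lemma sky_shortExact {f : M₁ →ₗ[A] M₂} {g : M₂ →ₗ[A] M₃} (hf : Function.Injective f)
    (hfg : Function.Exact f g) (hg : Function.Surjective g) :
    ∃ zero : skyMap i f ≫ skyMap i g = 0,
      (ShortComplex.mk (skyMap i f) (skyMap i g) zero).ShortExact := by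
  refine ⟨hom_ext fun j x => funext (α := PLift (j = i)) fun h => (hfg _).2 ⟨x h, rfl⟩,
    shortExact_iff.2 fun j => ⟨fun x y hxy => ?_, fun x => ⟨fun hx => ?_, ?_⟩, fun z => ?_⟩⟩
  · exact funext (α := PLift (j = i)) fun h => hf (congrFun hxy h)
  · choose y hy using fun h : PLift (j = i) => (hfg _).1 (congrFun hx h)
    exact ⟨y, funext hy⟩
  · rintro ⟨y, rfl⟩
    exact funext (α := PLift (j = i)) fun h => (hfg _).2 ⟨y h, rfl⟩
  · choose y hy using fun h : PLift (j = i) => hg (z h)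
    exact ⟨y, funext hy⟩

/-- Transport between branches at equal vertices. -/
def castBr (X : QuiverRep V A) {j l : V} (h : j = l) : X.br j →ₗ[A] X.br l := by
  subst h; exact LinearMap.id

open Classical in
/-- The homomorphism from a representation concentrated at a sink determined by its component. -/
noncomputable def skyDesc (hi : ∀ j, IsEmpty (i ⟶ j)) {X : QuiverRep V A} (a : M →ₗ[A] X.br i) :
    sky i M ⟶ X :=
  mkHom (X := sky i M) (fun j => if h : j = i then
      castBr X h.symm ∘ₗ a ∘ₗ LinearMap.proj (φ := fun _ : PLift (j = i) => M) ⟨h⟩ else 0)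
    fun j l α x => by
      have hj : j ≠ i := by rintro rfl; exact (hi l).elim α
      have := sky_subsingleton (M := M) hj
      rw [sky_toPath, Subsingleton.elim x 0, map_zero, map_zero, map_zero]

lemma skyDesc_of (hi : ∀ j, IsEmpty (i ⟶ j)) {X : QuiverRep V A} (a : M →ₗ[A] X.br i) (m : M) :
    homAt (skyDesc hi a) i (skyOf i M m) = a m := by
  rw [skyDesc, homAt_mkHom, dif_pos rfl]
  rfl

lemma sky_hom_ext {X : QuiverRep V A} {f g : sky i M ⟶ X}
    (h : ∀ m, homAt f i (skyOf i M m) = homAt g i (skyOf i M m)) : f = g := by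
  refine hom_ext fun j x => ?_
  by_cases hj : j = i
  · subst hj
    exact h (skyEval _ M x)
  · have := sky_subsingleton (M := M) hj
    rw [Subsingleton.elim x 0, map_zero, map_zero]

/-- The homomorphism to a concentrated representation determined by its component. -/
def skyLift {X : QuiverRep V A} (b : X.br i →ₗ[A] M) (hb : ∀ x ∈ X.imageSum i, b x = 0) :
    X ⟶ sky i M :=
  mkHom (Y := sky i M) (fun j => LinearMap.pi (φ := fun _ : PLift (j = i) => M)
    fun h => b ∘ₗ castBr X h.down) fun j l α x => by
      rw [sky_toPath]
      refine funext (α := PLift (l = i)) (β := fun _ => M) ?_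
      rintro ⟨rfl⟩
      exact hb _ (pathMap_mem_imageSum X α x)

lemma hom_sky_ext {X : QuiverRep V A} {f g : X ⟶ sky i M}
    (h : ∀ x, skyEval i M (homAt f i x) = skyEval i M (homAt g i x)) : f = g := by
  refine hom_ext fun j x => ?_
  by_cases hj : j = i
  · subst hj
    exact skyEval_bijective.1 (h x)
  · have := sky_subsingleton (M := M) hj
    exact Subsingleton.elim _ _

lemma skyEval_cokπ_iff {x : (sky i M).br i} :
    skyEval i M x = 0 ↔ (sky i M).cokπ i x = 0 := by
  rw [cokπ_eq_zero_iff, sky_imageSum, Submodule.mem_bot]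
  exact (map_eq_zero_iff _ skyEval_bijective.1)

variable [∀ i : V, Fintype (InArrow i)]

lemma skyEval_eq_zero {X : QuiverRep V A} (f : X ⟶ sky i M) {x : X.br i}
    (hx : x ∈ X.imageSum i) : skyEval i M (homAt f i x) = 0 := by
  have h := homAt_mem_imageSum f hx
  rw [sky_imageSum] at h
  rw [(Submodule.mem_bot A).1 h, map_zero]

/-- The map from the cokernel at a sink given by a map to a concentrated representation. -/
def cokDesc {X : QuiverRep V A} (f : X ⟶ sky i M) : X.cok i →ₗ[A] M :=
  (X.imageSum i).liftQ (skyEval i M ∘ₗ homAt f i) fun _ hx => skyEval_eq_zero f hx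

lemma sky_mem_smon (hi : ∀ j, IsEmpty (i ⟶ j))
    (h𝒳 : IsExtensionClosedIn (ModuleCat.isFG A) 𝒳) (hM : 𝒳 M) : smon I 𝒳 (sky i M) := by
  refine smon_iff.2 ⟨fun j => ?_, sky_satisfiesRelations, fun l x _ α => ?_, fun j => ?_⟩
  · have : Module.Finite A M := h𝒳.le _ hM
    exact inferInstanceAs (Module.Finite A (PLift (j = i) → M))
  · have hα : α.1 ≠ i := by
      rintro h
      exact (hi l).elim (h ▸ α.2)
    have := sky_subsingleton (M := M) hα
    rw [Subsingleton.elim (x α) 0]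
    exact zero_mem _
  · by_cases hj : j = i
    · subst hj
      exact h𝒳.mem_of_ker_eq skyEval_bijective.2 ((sky j M).cokπ_surjective j)
        (fun _ => skyEval_cokπ_iff) hM
    · have := sky_subsingleton (M := M) hj
      have : Subsingleton ((sky i M).br j ⧸ (sky i M).imageSum j) :=
        ((sky i M).cokπ_surjective j).subsingleton
      exact h𝒳.mem_of_subsingleton (M := (sky i M).br j ⧸ (sky i M).imageSum j)

lemma sky_isConflation (hi : ∀ j, IsEmpty (i ⟶ j))
    (h𝒳 : IsExtensionClosedIn (ModuleCat.isFG A) 𝒳) {S : ShortComplex (ModuleCat.{u} A)}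
    (hS : IsConflation 𝒳 S) : ∃ zero : skyMap i S.f.hom ≫ skyMap i S.g.hom = 0,
      IsConflation (smon I 𝒳) (ShortComplex.mk _ _ zero) := by
  obtain ⟨h₁, h₂, h₃⟩ := ModuleCat.exact_of_shortExact hS.shortExact
  obtain ⟨zero, h⟩ := sky_shortExact (i := i) h₁ h₂ h₃
  exact ⟨zero, h, sky_mem_smon hi h𝒳 hS.left, sky_mem_smon hi h𝒳 hS.middle,
    sky_mem_smon hi h𝒳 hS.right⟩

lemma cok_exact {S : ShortComplex (QuiverRep V A)} (hS : IsConflation (smon I 𝒳) S) (i : V) :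
    Function.Injective (cokMap S.f i) ∧ Function.Exact (cokMap S.f i) (cokMap S.g i) ∧
      Function.Surjective (cokMap S.g i) := by
  have h := shortExact_iff.1 hS.shortExact
  exact ⟨cokMap_injective (fun i x hx => (smon_iff.1 hS.right).2.2.1.mem_imageSum_of_homAt
      (fun i => (h i).2.1) (fun i => (h i).1) (fun i => (h i).2.2) (smon_iff.1 hS.middle).2.1 hx) i,
    cokMap_exact (fun i => (h i).2.1) (fun i => (h i).2.2) i,
    cokMap_surjective (fun i => (h i).2.2) i⟩

/-- The cokernel at `i` is left adjoint to `sky i`, which preserves conflations when `i` is a sink.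
-/
lemma cok_isProjectiveObject (hi : ∀ j, IsEmpty (i ⟶ j))
    (h𝒳 : IsExtensionClosedIn (ModuleCat.isFG A) 𝒳) {L : QuiverRep V A}
    (hL : IsProjectiveObject (smon I 𝒳) L) : IsProjectiveObject 𝒳 (L.cok i) := by
  refine ⟨(smon_iff.1 hL.1).2.2.2 i, fun S hS h => ?_⟩
  obtain ⟨zero, hc⟩ := sky_isConflation (I := I) hi h𝒳 hS
  obtain ⟨g, hg⟩ := hL.2 _ hc (skyLift (h.hom ∘ₗ L.cokπ i) fun x hx => by
    rw [LinearMap.comp_apply, cokπ_eq_zero_iff.2 hx, map_zero])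
  refine ⟨ModuleCat.ofHom (cokDesc g), ModuleCat.hom_ext (LinearMap.ext fun x => ?_)⟩
  obtain ⟨x, rfl⟩ := L.cokπ_surjective i x
  have h₁ := congrArg (fun t => skyEval i S.X₃ (homAt t i x)) hg
  exact h₁

lemma isProjectiveObject_of_sky (hi : ∀ j, IsEmpty (i ⟶ j))
    (h𝒳 : IsExtensionClosedIn (ModuleCat.isFG A) 𝒳) (hM : 𝒳 M)
    (hL : IsProjectiveObject (smon I 𝒳) (sky i M)) : IsProjectiveObject 𝒳 M := by
  refine ⟨hM, fun S hS h => ?_⟩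
  obtain ⟨zero, hc⟩ := sky_isConflation (I := I) hi h𝒳 hS
  obtain ⟨g, hg⟩ := hL.2 _ hc (skyMap i h.hom)
  refine ⟨ModuleCat.ofHom (skyEval i _ ∘ₗ homAt g i ∘ₗ skyOf i M),
    ModuleCat.hom_ext (LinearMap.ext fun x => ?_)⟩
  exact congrArg (fun t => skyEval i S.X₃ (homAt t i (skyOf i M x))) hg

lemma isInjectiveObject_of_sky (hi : ∀ j, IsEmpty (i ⟶ j))
    (h𝒳 : IsExtensionClosedIn (ModuleCat.isFG A) 𝒳) (hM : 𝒳 M)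
    (hL : IsInjectiveObject (smon I 𝒳) (sky i M)) : IsInjectiveObject 𝒳 M := by
  refine ⟨hM, fun S hS h => ?_⟩
  obtain ⟨zero, hc⟩ := sky_isConflation (I := I) hi h𝒳 hS
  obtain ⟨g, hg⟩ := hL.2 _ hc (skyMap i h.hom)
  refine ⟨ModuleCat.ofHom (skyEval i _ ∘ₗ homAt g i ∘ₗ skyOf i _),
    ModuleCat.hom_ext (LinearMap.ext fun x => ?_)⟩
  exact congrArg (fun t => skyEval i M (homAt t i (skyOf i _ x))) hg

/-- Homomorphisms to `sky i M` are linear maps from the cokernel at `i` to `M`, and cokernels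
preserve conflations. -/
lemma sky_isInjectiveObject (hi : ∀ j, IsEmpty (i ⟶ j))
    (h𝒳 : IsExtensionClosedIn (ModuleCat.isFG A) 𝒳) (hM : IsInjectiveObject 𝒳 M) :
    IsInjectiveObject (smon I 𝒳) (sky i M) := by
  refine ⟨sky_mem_smon hi h𝒳 hM.1, fun S hS h => ?_⟩
  obtain ⟨h₁, h₂, h₃⟩ := cok_exact hS i
  obtain ⟨b, hb⟩ := IsInjectiveObject.exists_extension hM h₁ h₂ h₃
    ((smon_iff.1 hS.left).2.2.2 i) ((smon_iff.1 hS.middle).2.2.2 i)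
    ((smon_iff.1 hS.right).2.2.2 i) (cokDesc h)
  refine ⟨skyLift (b ∘ₗ S.X₂.cokπ i) fun x hx => by
    rw [LinearMap.comp_apply, cokπ_eq_zero_iff.2 hx, map_zero], hom_sky_ext fun x => ?_⟩
  exact hb (S.X₁.cokπ i x)

variable [IsNoetherianRing A] [∀ i : V, Finite (Σ j : V, Quiver.Path j i)]

/-- At a sink, homomorphisms out of `sky i M` are linear maps from `M` to the branch at `i`, and
branches of conflations are conflations in `𝒳`. -/
lemma sky_isProjectiveObject (k : Type u) [Field k] [Algebra k A] {r : V → ℕ} (hr : IsRank r)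
    (hi : ∀ j, IsEmpty (i ⟶ j)) (h𝒳 : IsExtensionClosedIn (ModuleCat.isFG A) 𝒳)
    (hM : IsProjectiveObject 𝒳 M) : IsProjectiveObject (smon I 𝒳) (sky i M) := by
  refine ⟨sky_mem_smon hi h𝒳 hM.1, fun S hS h => ?_⟩
  obtain ⟨h₁, h₂, h₃⟩ := shortExact_iff.1 hS.shortExact i
  obtain ⟨b, hb⟩ := IsProjectiveObject.exists_lift hM h₁ h₂ h₃ (mem_br k hr h𝒳 hS.left i)
    (mem_br k hr h𝒳 hS.middle i) (mem_br k hr h𝒳 hS.right i) (homAt h i ∘ₗ skyOf i M)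
  refine ⟨skyDesc hi b, sky_hom_ext fun m => ?_⟩
  rw [homAt_comp, skyDesc_of]
  exact hb m

/-- The branch at a sink is right adjoint to `sky i`, which preserves conflations. -/
lemma br_isInjectiveObject (k : Type u) [Field k] [Algebra k A] {r : V → ℕ} (hr : IsRank r)
    (hi : ∀ j, IsEmpty (i ⟶ j)) (h𝒳 : IsExtensionClosedIn (ModuleCat.isFG A) 𝒳)
    {L : QuiverRep V A} (hL : IsInjectiveObject (smon I 𝒳) L) :
    IsInjectiveObject 𝒳 (L.br i) := by
  refine ⟨mem_br k hr h𝒳 hL.1 i, fun S hS h => ?_⟩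
  obtain ⟨zero, hc⟩ := sky_isConflation (I := I) hi h𝒳 hS
  obtain ⟨g, hg⟩ := hL.2 _ hc (skyDesc hi h.hom)
  refine ⟨ModuleCat.ofHom (homAt g i ∘ₗ skyOf i _),
    ModuleCat.hom_ext (LinearMap.ext fun x => ?_)⟩
  have h₁ := congrArg (fun t => homAt t i (skyOf i _ x)) hg
  exact h₁.trans (skyDesc_of hi h.hom x)

/-- For `M` in `𝒳`, apply the cokernel at the sink to a projective cover sequence of `sky i M`, and
the branch at the sink to an injective one. Both functors send `sky i M` back to `M`. The equality
of the two classes transfers because `sky i` preserves and reflects both. -/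
lemma isFrobeniusSubcategory_of_smon (k : Type u) [Field k] [Algebra k A] {r : V → ℕ}
    (hr : IsRank r) (hi : ∀ j, IsEmpty (i ⟶ j)) (h𝒳 : IsExtensionClosedIn (ModuleCat.isFG A) 𝒳)
    (h : IsFrobeniusSubcategory (boundRep A I) (smon I 𝒳)) :
    IsFrobeniusSubcategory (ModuleCat.isFG A) 𝒳 where
  extensionClosed := h𝒳
  enoughProjectives M hM := by
    obtain ⟨K, L, f, g, zero, hc, hL⟩ := h.enoughProjectives _ (sky_mem_smon (i := i) hi h𝒳 hM)
    obtain ⟨h₁, h₂, h₃⟩ := cok_exact hc i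
    have hbij : Function.Bijective (cokDesc (𝟙 (sky i M))) := by
      constructor
      · rw [injective_iff_map_eq_zero]
        intro x hx
        obtain ⟨x, rfl⟩ := (sky i M).cokπ_surjective i x
        exact skyEval_cokπ_iff.1 hx
      · intro m
        exact ⟨(sky i M).cokπ i (skyOf i M m), rfl⟩
    let e := LinearEquiv.ofBijective _ hbij
    have h₂' : Function.Exact (cokMap f i) (e.toLinearMap ∘ₗ cokMap g i) := by
      intro y
      refine Iff.trans ?_ (h₂ y)
      exact map_eq_zero_iff e e.injective
    refine ⟨K.cok i, L.cok i, ModuleCat.ofHom (cokMap f i),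
      ModuleCat.ofHom (e.toLinearMap ∘ₗ cokMap g i), (linearShortComplex _ _ h₂').zero,
      ⟨linearShortComplex_shortExact h₁ h₂' (e.surjective.comp h₃),
        (smon_iff.1 hc.left).2.2.2 i, (smon_iff.1 hc.middle).2.2.2 i, hM⟩,
      cok_isProjectiveObject hi h𝒳 hL⟩
  enoughInjectives M hM := by
    obtain ⟨L, Z, f, g, zero, hc, hL⟩ := h.enoughInjectives _ (sky_mem_smon (i := i) hi h𝒳 hM)
    obtain ⟨h₁, h₂, h₃⟩ := shortExact_iff.1 hc.shortExact i
    have h₂' : Function.Exact (homAt f i ∘ₗ skyOf i M) (homAt g i) := by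
      intro y
      refine (h₂ y).trans ⟨?_, ?_⟩
      · rintro ⟨x, rfl⟩
        exact ⟨skyEval i M x, rfl⟩
      · rintro ⟨m, rfl⟩
        exact ⟨_, rfl⟩
    refine ⟨L.br i, Z.br i, ModuleCat.ofHom (homAt f i ∘ₗ skyOf i M), ModuleCat.ofHom (homAt g i),
      (linearShortComplex _ _ h₂').zero,
      ⟨linearShortComplex_shortExact (fun x y hxy => ?_) h₂' h₃, hM,
        mem_br k hr h𝒳 hc.middle i, mem_br k hr h𝒳 hc.right i⟩,
      br_isInjectiveObject k hr hi h𝒳 hL⟩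
    exact congrArg (skyEval i M) (h₁ hxy)
  projective_iff_injective M := by
    constructor
    · intro hM
      exact isInjectiveObject_of_sky hi h𝒳 hM.1 ((h.projective_iff_injective _).1
        (sky_isProjectiveObject k hr hi h𝒳 hM))
    · intro hM
      exact isProjectiveObject_of_sky hi h𝒳 hM.1 ((h.projective_iff_injective _).2
        (sky_isInjectiveObject hi h𝒳 hM))

end QuiverRep

/-! ### A Frobenius subcategory outside the Gorenstein-projective modules -/

section Idempotent

variable {A : Type u} [Ring A]

/-- The finitely generated modules on which `e` acts as the identity. -/
def fixedModules (e : A) : ObjectProperty (ModuleCat.{u} A) := fun M =>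
  Module.Finite A M ∧ ∀ m : M, e • m = m

/-- In an extension, `e • m - m` comes from the submodule, so `e` fixes it; but `e` also kills it,
being idempotent. -/
lemma isExtensionClosedIn_fixedModules {e : A} (he : e * e = e) :
    IsExtensionClosedIn (ModuleCat.isFG A) (fixedModules e) where
  le _ h := h.1
  closedUnderIso := by
    refine ⟨fun {M N} f h => ⟨?_, fun n => ?_⟩⟩
    · have := h.1
      exact Module.Finite.equiv f.toLinearEquiv
    · have h₁ := h.2 (f.toLinearEquiv.symm n)
      rw [← map_smul] at h₁
      exact f.toLinearEquiv.symm.injective h₁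
  containsZero := ⟨ModuleCat.of A PUnit, ModuleCat.isZero_of_subsingleton _,
    inferInstanceAs (Module.Finite A PUnit.{u + 1}), fun _ => rfl⟩
  ext S hS h₂ h₁ h₃ := by
    obtain ⟨-, hex, -⟩ := ModuleCat.exact_of_shortExact hS
    refine ⟨h₂, fun m => ?_⟩
    obtain ⟨x, hx⟩ := (hex (e • m - m)).1 (by rw [map_sub, map_smul, h₃.2, sub_self])
    have h := h₁.2 x
    have h' : e • (e • m - m) = e • m - m := by rw [← hx, ← map_smul, h]
    rw [smul_sub, smul_smul, he, sub_self] at h'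
    exact (sub_eq_zero.1 h'.symm)

variable {k : Type u} [Field k] [Algebra k A] {e : A} {φ : A →ₐ[k] k}

/-- On such a module `a` acts as `e * a * e`, hence as the scalar `φ a`. The modules carry no more
structure than vector spaces over `k`. -/
lemma fixedModules.smul_eq (hφ : ∀ a, e * a * e = φ a • e) {M : ModuleCat.{u} A}
    (hM : fixedModules e M) (a : A) (m : M) : a • m = algebraMap k A (φ a) • m := by
  have h : (e * a * e) • m = a • m := by rw [mul_smul, mul_smul, hM.2, hM.2]
  rw [← h, hφ, Algebra.smul_def, mul_smul, hM.2]

/-- Linear maps over the field between such modules are linear over the algebra. -/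
noncomputable def fixedModules.linearMap (hφ : ∀ a, e * a * e = φ a • e) {M N : ModuleCat.{u} A}
    (hM : fixedModules e M) (hN : fixedModules e N)
    (t : (ModuleCat.restrictScalars (algebraMap k A)).obj M →ₗ[k]
      (ModuleCat.restrictScalars (algebraMap k A)).obj N) : M →ₗ[A] N where
  toFun := t
  map_add' := t.map_add
  map_smul' a m := by
    have h₁ := t.map_smul (φ a) m
    rw [RingHom.id_apply, hM.smul_eq hφ a m]
    exact h₁.trans (hN.smul_eq hφ a (t m)).symm

/-- Conflations split over `k`, and the splittings are automatically `A`-linear. -/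
lemma isProjectiveObject_fixedModules (hφ : ∀ a, e * a * e = φ a • e) {M : ModuleCat.{u} A}
    (hM : fixedModules e M) : IsProjectiveObject (fixedModules e) M := by
  refine ⟨hM, fun S hS h => ?_⟩
  obtain ⟨-, -, h₃⟩ := ModuleCat.exact_of_shortExact hS.shortExact
  obtain ⟨s, hs⟩ := LinearMap.exists_rightInverse_of_surjective
    ((ModuleCat.restrictScalars (algebraMap k A)).map S.g).hom (LinearMap.range_eq_top.2 h₃)
  refine ⟨ModuleCat.ofHom (fixedModules.linearMap hφ hS.right hS.middle s ∘ₗ h.hom),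
    ModuleCat.hom_ext (LinearMap.ext fun x => ?_)⟩
  exact LinearMap.congr_fun hs (h.hom x)

lemma isInjectiveObject_fixedModules (hφ : ∀ a, e * a * e = φ a • e) {M : ModuleCat.{u} A}
    (hM : fixedModules e M) : IsInjectiveObject (fixedModules e) M := by
  refine ⟨hM, fun S hS h => ?_⟩
  obtain ⟨h₁, -, -⟩ := ModuleCat.exact_of_shortExact hS.shortExact
  obtain ⟨s, hs⟩ := LinearMap.exists_leftInverse_of_injective
    ((ModuleCat.restrictScalars (algebraMap k A)).map S.f).hom (LinearMap.ker_eq_bot.2 h₁)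
  refine ⟨ModuleCat.ofHom (h.hom ∘ₗ fixedModules.linearMap hφ hS.middle hS.left s),
    ModuleCat.hom_ext (LinearMap.ext fun x => ?_)⟩
  exact congrArg h.hom (LinearMap.congr_fun hs x)

lemma isFrobeniusSubcategory_fixedModules (he : e * e = e) (hφ : ∀ a, e * a * e = φ a • e) :
    IsFrobeniusSubcategory (ModuleCat.isFG A) (fixedModules e) where
  extensionClosed := isExtensionClosedIn_fixedModules he
  enoughProjectives M hM := by
    have hex : Function.Exact (0 : PUnit.{u + 1} →ₗ[A] M) (LinearMap.id : M →ₗ[A] M) :=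
      fun m => ⟨fun h => ⟨0, h.symm⟩, by rintro ⟨_, rfl⟩; rfl⟩
    exact ⟨ModuleCat.of A PUnit, M, _, _, (linearShortComplex _ _ hex).zero,
      ⟨linearShortComplex_shortExact (fun _ _ _ => rfl) hex Function.surjective_id,
        (isExtensionClosedIn_fixedModules he).mem_of_subsingleton, hM, hM⟩,
      isProjectiveObject_fixedModules hφ hM⟩
  enoughInjectives M hM := by
    have hex : Function.Exact (LinearMap.id : M →ₗ[A] M) (0 : M →ₗ[A] PUnit.{u + 1}) :=
      fun m => ⟨fun _ => ⟨m, rfl⟩, fun _ => rfl⟩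
    exact ⟨M, ModuleCat.of A PUnit, _, _, (linearShortComplex _ _ hex).zero,
      ⟨linearShortComplex_shortExact Function.injective_id hex (fun _ => ⟨0, rfl⟩), hM, hM,
        (isExtensionClosedIn_fixedModules he).mem_of_subsingleton⟩,
      isInjectiveObject_fixedModules hφ hM⟩
  projective_iff_injective _ :=
    ⟨fun h => isInjectiveObject_fixedModules hφ h.1,
      fun h => isProjectiveObject_fixedModules hφ h.1⟩

variable (φ) in
/-- The one-dimensional module given by a character. -/
noncomputable abbrev characterModule : ModuleCat.{u} A :=
  (ModuleCat.restrictScalars φ.toRingHom).obj (ModuleCat.of k k)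

lemma characterModule_smul (a : A) (x : k) :
    a • (show characterModule φ from x) = (show characterModule φ from φ a * x) := rfl

lemma characterModule_mem (h : φ e = 1) : fixedModules e (characterModule φ) := by
  refine ⟨⟨{(show characterModule φ from (1 : k))}, ?_⟩, fun m => ?_⟩
  · rw [eq_top_iff]
    intro x _
    rw [Finset.coe_singleton, Submodule.mem_span_singleton]
    let c : k := x
    refine ⟨algebraMap k A c, (characterModule_smul (φ := φ) _ (1 : k)).trans ?_⟩
    change φ (algebraMap k A c) * (1 : k) = c
    rw [mul_one]
    exact φ.commutes c
  · refine (characterModule_smul (φ := φ) e m).trans ?_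
    let c : k := m
    change φ e * c = c
    rw [h, one_mul]

end Idempotent

namespace QuiverRep

variable {V : Type w} [Quiver.{w'} V] {I : MonomialRelations V} {A : Type u} [Ring A]
  [∀ i : V, Finite (Σ j : V, Quiver.Path j i)] [IsNoetherianRing A]

/-- A projective representation embeds in one generated by free modules. -/
lemma exists_embedding_freeRep {P : QuiverRep V A} (hP : IsProjectiveObject (boundRep A I) P) :
    ∃ (n : V → ℕ) (s : P ⟶ freeRep I fun i => ModuleCat.of A (Fin (n i) → A)),
      ∀ i, Function.Injective (homAt s i) := by
  have hgen : ∀ i, ∃ (n : ℕ) (f : (Fin n → A) →ₗ[A] P.br i), Function.Surjective f := fun i => by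
    have : Module.Finite A (P.br i) := hP.1.1 i
    exact Module.Finite.exists_fin' A (P.br i)
  choose n f hf using hgen
  let F : V → ModuleCat.{u} A := fun i => ModuleCat.of A (Fin (n i) → A)
  obtain ⟨g, hg⟩ : ∃ g : freeRep I F ⟶ P, ∀ i (x : F i), homAt g i (freeGen i x) = f i x :=
    ⟨freeHom (M := F) hP.1.2 f, fun i x => freeHom_gen (M := F) hP.1.2 f x⟩
  have hsurj : ∀ i, Function.Surjective (homAt g i) := fun i y => by
    obtain ⟨x, rfl⟩ := hf i y
    exact ⟨_, hg i x⟩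
  have := epi_of_surjective g hsurj
  have hS : (ShortComplex.mk (kernel.ι g) g (kernel.condition g)).ShortExact :=
    ⟨ShortComplex.exact_kernel g⟩
  have h := shortExact_iff.1 hS
  have hT : ∀ i, Module.Finite A ((freeRep I F).br i) :=
    finite_freeBr fun i => inferInstanceAs (Module.Finite A (Fin (n i) → A))
  obtain ⟨s, hs⟩ := hP.2 (ShortComplex.mk (kernel.ι g) g (kernel.condition g))
    ⟨hS, ⟨fun i => by
      have := hT i
      exact Module.Finite.of_injective _ (h i).1,
      (freeRep_satisfiesRelations (I := I) (M := F)).of_injective (homAt_isAddMap (kernel.ι g))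
        fun i => (h i).1⟩, ⟨hT, freeRep_satisfiesRelations⟩, hP.1⟩ (𝟙 P)
  refine ⟨n, s, fun i x y hxy => ?_⟩
  have h₁ : ∀ x, homAt g i (homAt s i x) = x := fun x =>
    congrArg (fun t => homAt t i x) hs
  rw [← h₁ x, hxy, h₁]

/-- A Gorenstein-projective representation embeds in a projective one, and so in one generated by
free modules. The generator at `i` is killed by the kernel of `φ`, so all the coordinates of its
image in copies of `A` are too, and by hypothesis they vanish. -/
lemma sky_not_gorensteinProjective {k : Type u} [Field k] [Algebra k A] {φ : A →ₐ[k] k}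
    (h : ∀ x : A, (∀ a, φ a = 0 → a * x = 0) → x = 0) (i : V) :
    ¬ gorensteinProjective (boundRep A I) (sky i (characterModule φ)) := by
  rintro ⟨-, P, hP, ⟨iso⟩⟩
  obtain ⟨n, s, hs⟩ := exists_embedding_freeRep (hP.projective 0)
  have hι : Function.Injective (homAt (iso.hom ≫ kernel.ι (P.d 0 1)) i) := injective_of_mono _ i
  let x : (sky i (characterModule φ)).br i :=
    skyOf i (characterModule φ) (show characterModule φ from (1 : k))
  have hx : ∀ a : A, φ a = 0 → a • x = 0 := by
    intro a ha
    refine ((skyOf i (characterModule φ)).map_smul a _).symm.trans ?_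
    rw [characterModule_smul, ha, zero_mul]
    exact map_zero _
  have hy : homAt s i (homAt (iso.hom ≫ kernel.ι (P.d 0 1)) i x) = 0 := by
    apply freeCoord_ext
    intro p
    rw [map_zero]
    funext c
    refine h _ fun a ha => ?_
    have h₁ := congrArg
      (fun t => freeCoord p (homAt s i (homAt (iso.hom ≫ kernel.ι (P.d 0 1)) i t)))
      (hx a ha)
    simp only [map_smul, map_zero] at h₁
    exact congrFun h₁ c
  have hx₀ : x = 0 := hι ((hs i (hy.trans (map_zero _).symm)).trans (map_zero _).symm)
  have := congrArg (skyEval i (characterModule φ)) hx₀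
  exact one_ne_zero (α := k) this

end QuiverRep

/-! ### A triangular algebra with a one-dimensional module that embeds in no free module. -/

section UpperTriangular

variable (k : Type u) [Field k]

/-- The algebra of upper triangular matrices of size two. -/
def upperTriangular : Subalgebra k (Matrix (Fin 2) (Fin 2) k) where
  carrier := {m | m 1 0 = 0}
  mul_mem' {a b} ha hb := by
    simp only [Set.mem_ofPred_eq] at ha hb ⊢
    simp [Matrix.mul_apply, Fin.sum_univ_two, ha, hb]
  add_mem' {a b} ha hb := by
    simp only [Set.mem_ofPred_eq] at ha hb ⊢
    simp [ha, hb]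
  algebraMap_mem' c := by
    simp [Matrix.algebraMap_matrix_apply]

namespace upperTriangular

/-- The character given by the lower diagonal entry. -/
def character : upperTriangular k →ₐ[k] k where
  toFun m := m.1 1 1
  map_one' := by simp
  map_zero' := rfl
  map_add' _ _ := rfl
  map_mul' a b := by
    have ha : a.1 1 0 = 0 := a.2
    simp [Matrix.mul_apply, Fin.sum_univ_two, ha]
  commutes' c := by
    simp [Matrix.algebraMap_matrix_apply]

/-- The lower diagonal idempotent. -/
def idem : upperTriangular k := ⟨!![0, 0; 0, 1], rfl⟩

lemma idem_mul_self : idem k * idem k = idem k := by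
  apply Subtype.ext
  change !![0, 0; 0, 1] * !![0, 0; 0, 1] = (!![0, 0; 0, 1] : Matrix (Fin 2) (Fin 2) k)
  ext i j
  fin_cases i <;> fin_cases j <;> simp

lemma idem_mul_mul_idem (a : upperTriangular k) :
    idem k * a * idem k = character k a • idem k := by
  apply Subtype.ext
  change !![0, 0; 0, 1] * a.1 * !![0, 0; 0, 1] =
    a.1 1 1 • (!![0, 0; 0, 1] : Matrix (Fin 2) (Fin 2) k)
  ext i j
  fin_cases i <;> fin_cases j <;>
    simp [Matrix.vecMul, dotProduct, Matrix.mul_apply, Fin.sum_univ_two]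

/-- The matrix units at positions `(0, 0)` and `(0, 1)` lie in the kernel of the character.
Multiplying by them moves the two rows of `x` to the top row, so both rows vanish. -/
lemma eq_zero_of_mul_eq_zero (x : upperTriangular k)
    (h : ∀ a, character k a = 0 → a * x = 0) : x = 0 := by
  have h₁ := congrArg Subtype.val (h ⟨!![1, 0; 0, 0], rfl⟩ rfl)
  have h₂ := congrArg Subtype.val (h ⟨!![0, 1; 0, 0], rfl⟩ rfl)
  change !![1, 0; 0, 0] * x.1 = 0 at h₁
  change !![0, 1; 0, 0] * x.1 = 0 at h₂
  apply Subtype.ext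
  ext i j
  have e₁ := congrFun (congrFun h₁ 0) j
  have e₂ := congrFun (congrFun h₂ 0) j
  simp only [Matrix.mul_apply, Fin.sum_univ_two] at e₁ e₂
  fin_cases i
  · simpa using e₁
  · simpa using e₂

end upperTriangular

end UpperTriangular

theorem corollary5p2 {k : Type u} [Field k] {V : Type w} [Quiver.{w'} V] [Finite V] [Nonempty V]
    [∀ i j : V, Finite (i ⟶ j)] (hV : IsAcyclicQuiver V) (I : MonomialRelations V) :
    (∀ (A : Type u) [Ring A] [Algebra k A] [FiniteDimensional k A]
      (𝒳 : ObjectProperty (ModuleCat.{u} A)),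
      IsExtensionClosedIn (ModuleCat.isFG A) 𝒳 →
        IsExtensionClosedIn (boundRep A I) (smon I 𝒳) ∧
        (IsFrobeniusSubcategory (boundRep A I) (smon I 𝒳) ↔
          IsFrobeniusSubcategory (ModuleCat.isFG A) 𝒳)) ∧
    (∃ (A : Type u) (_ : Ring A) (_ : Algebra k A) (_ : FiniteDimensional k A)
      (𝒳 : ObjectProperty (ModuleCat.{u} A)),
      IsFrobeniusSubcategory (ModuleCat.isFG A) 𝒳 ∧
        IsFrobeniusSubcategory (boundRep A I) (smon I 𝒳) ∧
        ¬ smon I 𝒳 ≤ gorensteinProjective (boundRep A I)) := by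
  obtain ⟨r, hr⟩ := hV.exists_isRank
  obtain ⟨i, hi⟩ := hr.exists_sink
  have : ∀ i : V, Fintype (InArrow i) := fun i => Fintype.ofFinite _
  have := hr.finite_paths
  constructor
  · intro A _ _ _ 𝒳 h𝒳
    have : IsNoetherianRing A := IsNoetherianRing.of_finite k A
    exact ⟨QuiverRep.isExtensionClosedIn_smon h𝒳,
      QuiverRep.isFrobeniusSubcategory_of_smon k hr hi h𝒳,
      QuiverRep.isFrobeniusSubcategory_smon k hr⟩
  · have : IsNoetherianRing (upperTriangular k) := IsNoetherianRing.of_finite k _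
    have h𝒳 := isFrobeniusSubcategory_fixedModules (upperTriangular.idem_mul_self k)
      (upperTriangular.idem_mul_mul_idem k)
    exact ⟨upperTriangular k, inferInstance, inferInstance, inferInstance,
      fixedModules (upperTriangular.idem k), h𝒳, QuiverRep.isFrobeniusSubcategory_smon k hr h𝒳,
      fun h => QuiverRep.sky_not_gorensteinProjective
        (upperTriangular.eq_zero_of_mul_eq_zero k) i (h _ (QuiverRep.sky_mem_smon hi
          h𝒳.extensionClosed (characterModule_mem rfl)))⟩
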